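/- Let $n\ge 2$, let $\Sigma=\prod_{i=1}^{n-1}(a_i,b_i)\subset\mathbb R^{n-1}$ with $a_i<b_i$, and let $I_a,I_b\subset\{1,\dots,n-1\}$. Let $\partial_D\Sigma$ be the interior (relative to $\partial\Sigma$) of the union of the faces $\{\bar x\in\partial\Sigma: \bar x_i=a_i\}$, $i\in I_a$, and $\{\bar x\in\partial\Sigma:\bar x_i=b_i\}$, $i\in I_b$, and let $\partial_N\Sigma$ be the interior of $\partial\Sigma\setminus\partial_D\Sigma$ relative to $\partial\Sigma$; assume $\partial_D\Sigma\ne\emptyset\ne\partial_N\Sigma$. Let $H^1(\Sigma,\partial_N\Sigma)$ be the space of $\phi\in H^1(\Sigma)$ with zero trace on $\partial_N\Sigma$. For $w\in L^2(\Sigma)^{n-1}$ with weak divergence $\nabla_{\bar x}\cdot w\in L^2(\Sigma)$ we say that $w\cdot\nu=0$ on $\partial_D\Sigma$ if $$\langle w\cdot\nu,\phi\rangle_{H^{-1/2}(\partial\Sigma),H^{1/2}(\partial\Sigma)}=\int_\Sigma \big(w\cdot\nabla_{\bar x}\phi+(\nabla_{\bar x}\cdot w)\,\phi\big)\,d\bar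 x=0\qquad\text{for all }\phi\in H^1(\Sigma,\partial_N\Sigma).$$ For a normed space $F$ and $\Gamma\subset\partial\Sigma$, let $C_0^\infty(\overline\Sigma\setminus\Gamma,F)$ be the space of functions $\overline\Sigma\to F$ that are restrictions of smooth functions on $\mathbb R^{n-1}$ and whose support is a subset of $\overline\Sigma\setminus\Gamma$. (i) Let $U\subset\mathbb R^n$ be open and bounded, and let $X(U)$ be a real Banach space of functions on $U$ that is continuously embedded in $L^1(U)$. For $u:\Sigma\to X(U)^{n-1}$ put $\bar u(\bar x)=\int_U u(\bar x,y)\,dy$. Then $C_0^\infty(\overline\Sigma\setminus\partial_D\Sigma,X(U))^{n-1}$ is a subset of $$\mathcal W=\{u\in L^2(\Sigma,X(U))^{n-1}:\ \nabla_{\bar x}\cdot\bar u\in L^2(\Sigma),\ \bar u\cdot\nu=0\text{ on }\partial_D\Sigma\}$$ and is dense in $\mathcal W$ with respect to the norm given by $\|u\|_{\mathcal W}^2=\|u\|_{L^2(\Sigma,X(U))}^2+\|\nabla_{\bar x}\cdot\bar u\|_{L^2(\Sigma)}^2$. (ii) Let $Z=(0,1)^{n-1}\times(-1,1)$ and let $Z_f\subset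 Z$ be open and connected with Lipschitz boundary, with $\partial Z_f\cap\big((0,1)^{n-1}\times\{\pm1\}\big)=\emptyset$ and $(\partial Z_f\cap\{y_i=0\})+e_i=\partial Z_f\cap\{y_i=1\}$ for $i=1,\dots,n-1$. Let $H^1_\#(Z)$ be the closure in $H^1(Z)$ of the functions of $H^1(Z)$ that are smooth on $\mathbb R^{n-1}\times(-1,1)$ and $1$-periodic in $y_1,\dots,y_{n-1}$, and let $H=H^1_\#(Z_f,\Gamma)$, $\Gamma=\partial Z_f\setminus\partial Z$, be the space of restrictions to $Z_f$ of functions of $H^1_\#(Z)$ that have zero trace on $\Gamma$, with the norm of $H^1(Z_f)$. For $u:\Sigma\to H^n$ let $\bar u=\big(\int_{Z_f}u_i(\cdot,y)\,dy\big)_{i=1}^{n-1}$. Then $$\mathcal V^\infty=\{u\in C_0^\infty(\overline\Sigma\setminus\partial_D\Sigma,H)^n:\ \nabla_y\cdot u=0\text{ in }\Sigma\times Z_f\}$$ is a subset of $$\mathcal V=\{u\in L^2(\Sigma,H)^n:\ \nabla_y\cdot u=0\text{ in }\Sigma\times Z_f,\ \nabla_{\bar x}\cdot\bar u\in L^2(\Sigma),\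 \bar u\cdot\nu=0\text{ on }\partial_D\Sigma\}$$ and is dense in $\mathcal V$ with respect to the norm given by $\|u\|_{\mathcal V}^2=\|\nabla_yu\|_{L^2(\Sigma\times Z_f)}^2+\|\nabla_{\bar x}\cdot\bar u\|_{L^2(\Sigma)}^2$. In both parts the approximating functions can be chosen with support disjoint from the closure of $\partial_D\Sigma$, i.e. with components in $C_0^\infty(\overline\Sigma\setminus\overline{\partial_D\Sigma},X(U))$ and $C_0^\infty(\overline\Sigma\setminus\overline{\partial_D\Sigma},H)$ respectively. -/

import Mathlib

open MeasureTheory Set Filter Topology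
open scoped ENNReal NNReal ContDiff

noncomputable section

namespace ThinLayer

/-- The Euclidean space `ℝ^m`. -/
abbrev E (m : ℕ) : Type := EuclideanSpace ℝ (Fin m)

/-- The `i`-th standard basis vector. -/
abbrev basisVec {m : ℕ} (i : Fin m) : E m := EuclideanSpace.single i (1 : ℝ)

/-! ### Sobolev spaces -/

/-- The zeroth and first order (classical) partial derivatives of a function:
`none` gives the function itself, `some i` gives its `i`-th partial derivative. -/
def jet {m : ℕ} (φ : E m → ℝ) : Option (Fin m) → E m → ℝ
  | none => φ
  | some i => fun x => fderiv ℝ φ x (basisVec i)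

/-- Families `(f, g₁, …, g_m)` of `L²(O)`-functions, with the norm
`(‖f‖² + ‖g₁‖² + ⋯ + ‖g_m‖²)^{1/2}`. The space `H¹(O)` sits in it isometrically through
`f ↦ (f, ∂₁f, …, ∂_m f)`. -/
abbrev L2Jet {m : ℕ} (O : Set (E m)) : Type :=
  PiLp 2 (fun _ : Option (Fin m) => Lp ℝ 2 (volume.restrict O))

/-- Test functions: the elements of `C_c^∞(O)`. -/
structure IsTestFun {m : ℕ} (O : Set (E m)) (φ : E m → ℝ) : Prop where
  smooth : ContDiff ℝ ∞ φ
  compact : HasCompactSupport φ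
  supp : tsupport φ ⊆ O

theorem continuous_jet {m : ℕ} {φ : E m → ℝ} (h : ContDiff ℝ ∞ φ) (k : Option (Fin m)) :
    Continuous (jet φ k) := by
  cases k with
  | none => exact h.continuous
  | some i => exact (h.continuous_fderiv (by simp)).clm_apply continuous_const

theorem IsTestFun.memLp_jet {m : ℕ} {O : Set (E m)} {φ : E m → ℝ} (h : IsTestFun O φ)
    (k : Option (Fin m)) : MemLp (jet φ k) 2 (volume.restrict O) := by
  refine ((continuous_jet h.smooth k).memLp_of_hasCompactSupport ?_).restrict O
  cases k with
  | none => exact h.compact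
  | some i => exact h.compact.fderiv_apply (𝕜 := ℝ) _

theorem integrable_mul_jet {m : ℕ} {O : Set (E m)} {φ : E m → ℝ} (h : IsTestFun O φ)
    (f : Lp ℝ 2 (volume.restrict O)) (k : Option (Fin m)) :
    Integrable (fun x => f x * jet φ k x) (volume.restrict O) :=
  (Lp.memLp f).integrable_mul (h.memLp_jet k)

/-- The Sobolev space `H¹(O)`: those `v = (f, g₁, …, g_m)` for which `g_i` is the `i`-th weak
partial derivative of `f` in `O`. -/
def H1 {m : ℕ} (O : Set (E m)) : Submodule ℝ (L2Jet O) where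
  carrier := {v | ∀ φ : E m → ℝ, IsTestFun O φ → ∀ i : Fin m,
    ∫ x in O, v none x * jet φ (some i) x = - ∫ x in O, v (some i) x * φ x}
  zero_mem' := by
    intro φ _ i
    have h : ∀ ψ : E m → ℝ, ∫ x in O, (0 : Lp ℝ 2 (volume.restrict O)) x * ψ x = 0 := by
      intro ψ
      refine integral_eq_zero_of_ae ?_
      filter_upwards [Lp.coeFn_zero ℝ 2 (volume.restrict O)] with x hx
      simp only [hx, Pi.zero_apply, zero_mul]
    simp only [PiLp.zero_apply, h, neg_zero]
  add_mem' := by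
    intro v w hv hw φ hφ i
    have h : ∀ (f g : Lp ℝ 2 (volume.restrict O)) (k : Option (Fin m)),
        ∫ x in O, (f + g) x * jet φ k x
          = (∫ x in O, f x * jet φ k x) + ∫ x in O, g x * jet φ k x := by
      intro f g k
      rw [← integral_add (integrable_mul_jet hφ f k) (integrable_mul_jet hφ g k)]
      refine integral_congr_ae ?_
      filter_upwards [Lp.coeFn_add f g] with x hx
      simp only [hx, Pi.add_apply, add_mul]
    have h1 := h (v none) (w none) (some i)
    have h2 := h (v (some i)) (w (some i)) none
    have h3 := hv φ hφ i
    have h4 := hw φ hφ i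
    simp only [jet, PiLp.add_apply] at *
    linarith
  smul_mem' := by
    intro c v hv φ hφ i
    have h : ∀ (f : Lp ℝ 2 (volume.restrict O)) (ψ : E m → ℝ),
        ∫ x in O, (c • f) x * ψ x = c * ∫ x in O, f x * ψ x := by
      intro f ψ
      rw [← integral_const_mul]
      refine integral_congr_ae ?_
      filter_upwards [Lp.coeFn_smul c f] with x hx
      simp [hx, mul_assoc]
    have h3 := hv φ hφ i
    simp only [PiLp.smul_apply, h] at *
    rw [h3]; ring

/-- Vanishing trace on a part `Γ` of the boundary of `O`. The trace operator is the continuous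
extension to `H¹(O)` of `φ ↦ φ|_{∂O}`, for `φ` smooth up to the boundary, with values in `L²` of
the boundary with its surface measure (here the Hausdorff measure of dimension `m - 1`); so `v` has
vanishing trace on `Γ` if it is the `H¹(O)`-limit of such `φ_k` with `φ_k → 0` in `L²(Γ)`. -/
def TraceZero {m : ℕ} (O Γ : Set (E m)) : Submodule ℝ (L2Jet O) where
  carrier := {v | ∃ φ : ℕ → E m → ℝ, (∀ k, ContDiff ℝ ∞ (φ k)) ∧
    (∀ j, Tendsto (fun k => eLpNorm (jet (φ k) j - (v j : E m → ℝ)) 2 (volume.restrict O)) atTop (𝓝 0)) ∧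
    Tendsto (fun k => eLpNorm (φ k) 2 ((μH[(m : ℝ) - 1] : Measure (E m)).restrict Γ))
      atTop (𝓝 0)}
  zero_mem' := by
    refine ⟨fun _ _ => 0, fun _ => contDiff_const, fun j => ?_, ?_⟩
    · have h : jet (fun _ : E m => (0 : ℝ)) j = 0 := by
        cases j <;> ext x <;> simp [jet]
      have h0 : eLpNorm (jet (fun _ : E m => (0 : ℝ)) j - ((0 : L2Jet O) j : E m → ℝ)) 2
          (volume.restrict O) = 0 := by
        rw [h, ← eLpNorm_zero (α := E m) (ε := ℝ) (p := 2) (μ := volume.restrict O)]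
        refine eLpNorm_congr_ae ?_
        filter_upwards [Lp.coeFn_zero ℝ 2 (volume.restrict O)] with x hx
        simp only [Pi.sub_apply, PiLp.zero_apply, hx, Pi.zero_apply, sub_zero]
      simp only [h0]
      exact tendsto_const_nhds
    · have h0 : eLpNorm (fun _ : E m => (0 : ℝ)) 2
          ((μH[(m : ℝ) - 1] : Measure (E m)).restrict Γ) = 0 := eLpNorm_zero
      simp only [h0]
      exact tendsto_const_nhds
  add_mem' := by
    rintro v w ⟨φ, hφ, h1, h2⟩ ⟨ψ, hψ, h3, h4⟩
    refine ⟨fun k => φ k + ψ k, fun k => (hφ k).add (hψ k), fun j => ?_, ?_⟩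
    · have hs := (h1 j).add (h3 j)
      rw [add_zero] at hs
      refine tendsto_of_tendsto_of_tendsto_of_le_of_le tendsto_const_nhds hs
        (fun _ => zero_le) (fun k => ?_)
      have hj : jet (φ k + ψ k) j = jet (φ k) j + jet (ψ k) j := by
        cases j with
        | none => rfl
        | some i =>
          ext x
          have a1 := (hφ k).differentiable (by simp) x
          have a2 := (hψ k).differentiable (by simp) x
          simp [jet, fderiv_add a1 a2]
      refine le_trans (le_of_eq (eLpNorm_congr_ae ?_)) (eLpNorm_add_le
        ((continuous_jet (hφ k) j).aestronglyMeasurable.sub (Lp.aestronglyMeasurable (v j)))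
        ((continuous_jet (hψ k) j).aestronglyMeasurable.sub (Lp.aestronglyMeasurable (w j)))
        (by norm_num))
      filter_upwards [Lp.coeFn_add (v j) (w j)] with x hx
      simp only [hj, PiLp.add_apply, Pi.sub_apply, Pi.add_apply, hx]
      ring
    · have hs := h2.add h4
      rw [add_zero] at hs
      exact tendsto_of_tendsto_of_tendsto_of_le_of_le tendsto_const_nhds hs
        (fun _ => zero_le) (fun k => eLpNorm_add_le
          (hφ k).continuous.aestronglyMeasurable (hψ k).continuous.aestronglyMeasurable
          (by norm_num))
  smul_mem' := by
    rintro c v ⟨φ, hφ, h1, h2⟩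
    refine ⟨fun k => c • φ k, fun k => contDiff_const.smul (hφ k), fun j => ?_, ?_⟩
    · have hs := ENNReal.Tendsto.const_mul (a := ‖c‖ₑ) (h1 j) (Or.inr (by simp))
      rw [mul_zero] at hs
      refine hs.congr (fun k => ?_)
      rw [← eLpNorm_const_smul]
      refine eLpNorm_congr_ae ?_
      have hj : jet (c • φ k) j = c • jet (φ k) j := by
        cases j with
        | none => rfl
        | some i =>
          ext x
          have a1 := (hφ k).differentiable (by simp) x
          simp [jet, fderiv_const_smul a1]
      filter_upwards [Lp.coeFn_smul c (v j)] with x hx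
      simp only [hj, PiLp.smul_apply, Pi.sub_apply, Pi.smul_apply, hx, smul_sub]
    · have hs := ENNReal.Tendsto.const_mul (a := ‖c‖ₑ) h2 (Or.inr (by simp))
      rw [mul_zero] at hs
      exact hs.congr (fun k => (eLpNorm_const_smul _ _ _ _).symm)

/-- `H¹(O, Γ)`: the functions of `H¹(O)` with vanishing trace on `Γ ⊆ ∂O`. -/
def H1Zero {m : ℕ} (O Γ : Set (E m)) : Submodule ℝ (L2Jet O) := H1 O ⊓ TraceZero O Γ

/-! ### The macroscopic domain `Σ` and its boundary parts -/

/-- The open box `Σ = (a, b) ⊆ ℝ^d`. -/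
def box {d : ℕ} (a b : Fin d → ℝ) : Set (E d) := {x | ∀ i, x i ∈ Ioo (a i) (b i)}

/-- Interior of `A` relative to `B` (for `A ⊆ B`). -/
def relInt {m : ℕ} (B A : Set (E m)) : Set (E m) :=
  {x | x ∈ A ∧ ∃ V : Set (E m), IsOpen V ∧ x ∈ V ∧ V ∩ B ⊆ A}

/-- `∂_D Σ`: the interior, relative to `∂Σ`, of the union of the faces `x_i = a_i`, `i ∈ Ia`, and
`x_i = b_i`, `i ∈ Ib`. -/
def bdryD {d : ℕ} (a b : Fin d → ℝ) (Ia Ib : Set (Fin d)) : Set (E d) :=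
  relInt (frontier (box a b))
    ((⋃ i ∈ Ia, {x | x ∈ frontier (box a b) ∧ x i = a i}) ∪
      ⋃ i ∈ Ib, {x | x ∈ frontier (box a b) ∧ x i = b i})

/-- `∂_N Σ`: the interior of `∂Σ ∖ ∂_D Σ` relative to `∂Σ`. -/
def bdryN {d : ℕ} (a b : Fin d → ℝ) (Ia Ib : Set (Fin d)) : Set (E d) :=
  relInt (frontier (box a b)) (frontier (box a b) \ bdryD a b Ia Ib)

/-- `C_0^∞(closure S ∖ Γ, F)` for a bounded set `S`: functions that are smooth up to the boundary
of `S` and whose support in `closure S` is a (compact) subset of `closure S ∖ Γ`. Only the values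
on `closure S` matter. -/
def CcInfty {d : ℕ} (S Γ : Set (E d)) (F : Type*) [NormedAddCommGroup F] [NormedSpace ℝ F] :
    Set (E d → F) :=
  {ψ | ContDiff ℝ ∞ ψ ∧ closure (closure S ∩ Function.support ψ) ⊆ closure S \ Γ}

/-! ### Weak divergence and normal trace -/

/-- `g ∈ L²(S)` is the weak divergence of the vector field `w` in `S`. -/
def IsWeakDiv {d : ℕ} (S : Set (E d)) (w : Fin d → E d → ℝ) (g : E d → ℝ) : Prop :=
  MemLp g 2 (volume.restrict S) ∧ ∀ φ : E d → ℝ, IsTestFun S φ →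
    ∫ x in S, ∑ i, w i x * jet φ (some i) x = - ∫ x in S, g x * φ x

/-- The weak divergence of `w` is in `L²(S)`. -/
def HasL2Div {d : ℕ} (S : Set (E d)) (w : Fin d → E d → ℝ) : Prop := ∃ g, IsWeakDiv S w g

open Classical in
/-- The weak divergence of `w` (unique almost everywhere), if it is in `L²(S)`. -/
def weakDiv {d : ℕ} (S : Set (E d)) (w : Fin d → E d → ℝ) : E d → ℝ :=
  if h : HasL2Div S w then h.choose else 0

/-- The pairing `⟨w·ν, φ⟩` between `H^{-1/2}(∂S)` and `H^{1/2}(∂S)`, for `w` with divergence in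
`L²(S)` and `φ ∈ H¹(S)`; it is defined by Green's formula. -/
def normalPairing {d : ℕ} (S : Set (E d)) (w : Fin d → E d → ℝ) (φ : L2Jet S) : ℝ :=
  ∫ x in S, ((∑ i, w i x * φ (some i) x) + weakDiv S w x * φ none x)

/-- `w·ν = 0` on the part of `∂S` that is complementary to `N`: the normal trace of `w` vanishes
on all functions of `H¹(S, N)`. -/
def NormalTraceZeroOff {d : ℕ} (S N : Set (E d)) (w : Fin d → E d → ℝ) : Prop :=
  ∀ φ ∈ H1Zero S N, normalPairing S w φ = 0

/-! ### The space `𝒲` -/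

/-- The mean `∫_U u(x, y) dy` of an `X(U)^k`-valued function, where `ι` is the inclusion
`X(U) → L¹(U)`. -/
def mean {d k : ℕ} {U : Set (E (d + 1))} {X : Type*} [NormedAddCommGroup X] [NormedSpace ℝ X]
    (ι : X →L[ℝ] Lp ℝ 1 (volume.restrict U)) (u : Fin k → E d → X) : Fin k → E d → ℝ :=
  fun i x => ∫ y in U, ι (u i x) y

/-- The space `𝒲` of all `u ∈ L²(Σ, X(U))^d` whose mean has divergence in `L²(Σ)` and vanishing
normal trace on `∂_D Σ`. -/
def spaceW {d : ℕ} (a b : Fin d → ℝ) (Ia Ib : Set (Fin d)) {U : Set (E (d + 1))} {X : Type*}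
    [NormedAddCommGroup X] [NormedSpace ℝ X] (ι : X →L[ℝ] Lp ℝ 1 (volume.restrict U)) :
    Set (Fin d → E d → X) :=
  {u | (∀ i, MemLp (u i) 2 (volume.restrict (box a b))) ∧ HasL2Div (box a b) (mean ι u) ∧
    NormalTraceZeroOff (box a b) (bdryN a b Ia Ib) (mean ι u)}

/-- The norm of `𝒲`. -/
def normW {d : ℕ} (a b : Fin d → ℝ) {U : Set (E (d + 1))} {X : Type*}
    [NormedAddCommGroup X] [NormedSpace ℝ X] (ι : X →L[ℝ] Lp ℝ 1 (volume.restrict U))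
    (u : Fin d → E d → X) : ℝ≥0∞ :=
  ((∑ i, eLpNorm (u i) 2 (volume.restrict (box a b)) ^ 2) +
    eLpNorm (weakDiv (box a b) (mean ι u)) 2 (volume.restrict (box a b)) ^ 2) ^ (1 / 2 : ℝ)

/-! ### The reference cell and the space `H¹_#(Z_f, Γ)` -/

/-- The cell `Z = (0,1)^d × (-1,1)`. -/
def cell (d : ℕ) : Set (E (d + 1)) :=
  {y | (∀ i : Fin d, y i.castSucc ∈ Ioo (0 : ℝ) 1) ∧ y (Fin.last d) ∈ Ioo (-1 : ℝ) 1}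

/-- The layer `ℝ^d × (-1,1)`. -/
def layer (d : ℕ) : Set (E (d + 1)) := {y | y (Fin.last d) ∈ Ioo (-1 : ℝ) 1}

/-- Top and bottom `(0,1)^d × {±1}` of the cell. -/
def topBottom (d : ℕ) : Set (E (d + 1)) :=
  {y | (∀ i : Fin d, y i.castSucc ∈ Ioo (0 : ℝ) 1) ∧
    (y (Fin.last d) = 1 ∨ y (Fin.last d) = -1)}

/-- `O` has Lipschitz boundary: near each boundary point, `O` is the set above the graph, in some
direction `ν`, of a Lipschitz function of the component orthogonal to `ν`. -/
def HasLipschitzBoundary {m : ℕ} (O : Set (E m)) : Prop :=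
  ∀ x ∈ frontier O, ∃ ν : E m, ‖ν‖ = 1 ∧ ∃ r > 0, ∃ (K : ℝ≥0) (γ : E m → ℝ), LipschitzWith K γ ∧
    O ∩ Metric.ball x r =
      {y | γ (y - inner ℝ y ν • ν) < inner ℝ y ν} ∩ Metric.ball x r

/-- The geometric assumptions on the fluid part `Z_f` of the cell. -/
structure IsFluidCell {d : ℕ} (Zf : Set (E (d + 1))) : Prop where
  subset : Zf ⊆ cell d
  isOpen : IsOpen Zf
  connected : IsConnected Zf
  lipschitz : HasLipschitzBoundary Zf
  off_topBottom : topBottom d ∩ frontier Zf = ∅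
  periodic : ∀ i : Fin d,
    (fun y => y + basisVec i.castSucc) '' (frontier Zf ∩ {y | y i.castSucc = 0}) =
      frontier Zf ∩ {y | y i.castSucc = 1}

/-- `f ∈ C_#^∞(Z)`: smooth in the layer and periodic with period one in the first `d` variables. -/
structure IsSmoothPeriodic {d : ℕ} (f : E (d + 1) → ℝ) : Prop where
  smooth : ContDiffOn ℝ ∞ f (layer d)
  periodic : ∀ y ∈ layer d, ∀ i : Fin d, f (y + basisVec i.castSucc) = f y

theorem isOpen_layer (d : ℕ) : IsOpen (layer d) := by
  have h : Continuous fun y : E (d + 1) => y (Fin.last d) := by fun_prop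
  exact isOpen_Ioo.preimage h

theorem isOpen_cell (d : ℕ) : IsOpen (cell d) := by
  have h : ∀ i, Continuous fun y : E (d + 1) => y i := fun i => by fun_prop
  have h2 : cell d = (⋂ i : Fin d, (fun y : E (d + 1) => y i.castSucc) ⁻¹' Ioo (0 : ℝ) 1) ∩
      (fun y : E (d + 1) => y (Fin.last d)) ⁻¹' Ioo (-1 : ℝ) 1 := by
    ext y; simp [cell]
  rw [h2]
  exact (isOpen_iInter_of_finite fun i => isOpen_Ioo.preimage (h _)).inter
    (isOpen_Ioo.preimage (h _))

theorem IsSmoothPeriodic.differentiableAt {d : ℕ} {f : E (d + 1) → ℝ} (h : IsSmoothPeriodic f)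
    {y : E (d + 1)} (hy : y ∈ cell d) : DifferentiableAt ℝ f y :=
  ((h.smooth y hy.2).contDiffAt ((isOpen_layer d).mem_nhds hy.2)).differentiableAt (by simp)

/-- The functions of `C_#^∞(Z)` that belong to `H¹(Z)`. -/
def smoothPer (d : ℕ) : Submodule ℝ (L2Jet (cell d)) where
  carrier := {v | ∃ f : E (d + 1) → ℝ, IsSmoothPeriodic f ∧
    ∀ k, v k =ᵐ[volume.restrict (cell d)] jet f k}
  zero_mem' := by
    refine ⟨fun _ => 0, ⟨contDiffOn_const, fun _ _ _ => rfl⟩, fun k => ?_⟩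
    filter_upwards [Lp.coeFn_zero ℝ 2 (volume.restrict (cell d))] with x hx
    rw [PiLp.zero_apply, hx]
    cases k <;> simp [jet]
  add_mem' := by
    rintro v w ⟨f, hf, hv⟩ ⟨g, hg, hw⟩
    refine ⟨f + g, ⟨hf.smooth.add hg.smooth, fun y hy i => ?_⟩, fun k => ?_⟩
    · simp [hf.periodic y hy i, hg.periodic y hy i]
    · filter_upwards [Lp.coeFn_add (v k) (w k), hv k, hw k,
        ae_restrict_mem (isOpen_cell d).measurableSet] with x hx h1 h2 hm
      have e : (v + w) k x = jet f k x + jet g k x := by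
        rw [PiLp.add_apply, hx, Pi.add_apply, h1, h2]
      rw [e]
      cases k with
      | none => rfl
      | some i => simp [jet, fderiv_add (hf.differentiableAt hm) (hg.differentiableAt hm)]
  smul_mem' := by
    rintro c v ⟨f, hf, hv⟩
    refine ⟨c • f, ⟨contDiffOn_const.smul hf.smooth, fun y hy i => ?_⟩, fun k => ?_⟩
    · simp [hf.periodic y hy i]
    · filter_upwards [Lp.coeFn_smul c (v k), hv k,
        ae_restrict_mem (isOpen_cell d).measurableSet] with x hx h1 hm
      have e : (c • v) k x = c • jet f k x := by
        rw [PiLp.smul_apply, hx, Pi.smul_apply, h1]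
      rw [e]
      cases k with
      | none => rfl
      | some i => simp [jet, fderiv_const_smul (hf.differentiableAt hm)]

/-- `H¹_#(Z)`: the closure of `C_#^∞(Z)` in `H¹(Z)`. -/
def H1Per (d : ℕ) : Submodule ℝ (L2Jet (cell d)) := H1 (cell d) ⊓ (smoothPer d).topologicalClosure

/-- `H¹_#(Z_f)`: the restrictions to `Z_f` of the functions of `H¹_#(Z)`; here `Z_f ⊆ Z`, so that
`Z_f ∩ Z = Z_f`. -/
def H1PerRestrict {d : ℕ} (Zf : Set (E (d + 1))) : Submodule ℝ (L2Jet Zf) where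
  carrier := {v | ∃ V ∈ H1Per d, ∀ k, v k =ᵐ[volume.restrict (Zf ∩ cell d)] V k}
  zero_mem' := by
    refine ⟨0, zero_mem _, fun k => ?_⟩
    filter_upwards [ae_mono (Measure.restrict_mono inter_subset_left le_rfl)
        (Lp.coeFn_zero ℝ 2 (volume.restrict Zf)),
      ae_mono (Measure.restrict_mono inter_subset_right le_rfl)
        (Lp.coeFn_zero ℝ 2 (volume.restrict (cell d)))] with x h1 h2
    simp only [PiLp.zero_apply, h1, h2]
  add_mem' := by
    rintro v w ⟨V, hV, hv⟩ ⟨W, hW, hw⟩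
    refine ⟨V + W, add_mem hV hW, fun k => ?_⟩
    filter_upwards [ae_mono (Measure.restrict_mono inter_subset_left le_rfl)
        (Lp.coeFn_add (v k) (w k)),
      ae_mono (Measure.restrict_mono inter_subset_right le_rfl)
        (Lp.coeFn_add (V k) (W k)), hv k, hw k] with x h1 h2 h3 h4
    simp only [PiLp.add_apply, h1, h2, Pi.add_apply, h3, h4]
  smul_mem' := by
    rintro c v ⟨V, hV, hv⟩
    refine ⟨c • V, Submodule.smul_mem _ c hV, fun k => ?_⟩
    filter_upwards [ae_mono (Measure.restrict_mono inter_subset_left le_rfl)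
        (Lp.coeFn_smul c (v k)),
      ae_mono (Measure.restrict_mono inter_subset_right le_rfl)
        (Lp.coeFn_smul c (V k)), hv k] with x h1 h2 h3
    simp only [PiLp.smul_apply, h1, h2, Pi.smul_apply, h3]

/-- `H¹_#(Z_f, Γ)` with `Γ = ∂Z_f ∖ ∂Z`: the functions of `H¹_#(Z_f)` that vanish on `Γ`. -/
def H1PerZero {d : ℕ} (Zf : Set (E (d + 1))) : Submodule ℝ (L2Jet Zf) :=
  H1PerRestrict Zf ⊓ TraceZero Zf (frontier Zf \ frontier (cell d))

/-! ### The spaces `𝒱` and `𝒱^∞` -/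

/-- `∇_y · v = 0` in `Z_f`, for `v ∈ H¹_#(Z_f, Γ)^n`, `n = d + 1`. -/
def DivFree {d : ℕ} {Zf : Set (E (d + 1))} (v : Fin (d + 1) → H1PerZero Zf) : Prop :=
  ∑ j, (v j : L2Jet Zf) (some j) = 0

/-- The first `d = n - 1` components of the mean `∫_{Z_f} u(x, y) dy`. -/
def meanV {d : ℕ} {Zf : Set (E (d + 1))} (u : Fin (d + 1) → E d → H1PerZero Zf) :
    Fin d → E d → ℝ :=
  fun i x => ∫ y in Zf, (u i.castSucc x : L2Jet Zf) none y

/-- The space `𝒱` of all `u ∈ L²(Σ, H¹_#(Z_f, Γ))^n` with `∇_y · u = 0` whose mean has divergence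
in `L²(Σ)` and vanishing normal trace on `∂_D Σ`. -/
def spaceV {d : ℕ} (a b : Fin d → ℝ) (Ia Ib : Set (Fin d)) (Zf : Set (E (d + 1))) :
    Set (Fin (d + 1) → E d → H1PerZero Zf) :=
  {u | (∀ i, MemLp (u i) 2 (volume.restrict (box a b))) ∧
    (∀ᵐ x ∂(volume.restrict (box a b)), DivFree fun i => u i x) ∧
    HasL2Div (box a b) (meanV u) ∧
    NormalTraceZeroOff (box a b) (bdryN a b Ia Ib) (meanV u)}

/-- The norm of `𝒱`:
`(‖∇_y u‖²_{L²(Σ × Z_f)} + ‖∇_x · ū‖²_{L²(Σ)})^{1/2}`. -/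
def normV {d : ℕ} (a b : Fin d → ℝ) {Zf : Set (E (d + 1))}
    (u : Fin (d + 1) → E d → H1PerZero Zf) : ℝ≥0∞ :=
  ((∑ i, ∑ j : Fin (d + 1), eLpNorm (fun x => (u i x : L2Jet Zf) (some j)) 2
      (volume.restrict (box a b)) ^ 2) +
    eLpNorm (weakDiv (box a b) (meanV u)) 2 (volume.restrict (box a b)) ^ 2) ^ (1 / 2 : ℝ)

/-- The fields with components in `C_0^∞(closure Σ ∖ Γ, H¹_#(Z_f, Γ_f))` that satisfy
`∇_y · u = 0` in `Σ × Z_f`. For `Γ = ∂_D Σ` this is `𝒱^∞`. -/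
def spaceVInfty {d : ℕ} (a b : Fin d → ℝ) (Γ : Set (E d)) (Zf : Set (E (d + 1))) :
    Set (Fin (d + 1) → E d → H1PerZero Zf) :=
  {u | (∀ i, u i ∈ CcInfty (box a b) Γ (H1PerZero Zf)) ∧
    ∀ x ∈ box a b, DivFree fun i => u i x}

end ThinLayer

end

noncomputable section

namespace ThinLayer

/-! ### Geometry of the box -/

/-! The density rests on mollification with shifted kernels. The field is extended by zero outside
the box, and the box is covered by one patch per vertex, with the smooth partition of unity `cut`.
In the patch `s` the kernel is shifted so that the value at `x` is an average over points displaced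
outwards across the nearby faces of `∂_D Σ` and inwards from the nearby faces of `∂_N Σ`
(`exists_isAdapted`). Near `∂_D Σ` the average then sees only the zero extension, so the smoothed
field vanishes near the closure of `∂_D Σ` (`glue_mem_CcInfty`).

For `x` in the patch, the function `z ↦ κ s (x - z)` vanishes on `∂_N Σ`, so it is admissible in the
definition of vanishing normal trace. Hence mollification commutes with the divergence there
(`sum_conv_fderiv_eq`). What remains in the divergence of the glued field are the terms with `∂_i
(cut s)`; they converge to `∑ w_i ∂_i (∑ cut s) = 0` (`eLpNorm_divGlue_sub_le`).

Two further points concern values in a normed space `F`, which need not be complete and which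
encodes the constraint `∇_y · u = 0` as a subspace. First, the errors are measured in the completion
of `F`. Secondly, once the kernels are fixed, smoothing followed by the divergence is bounded in
`L²` for arbitrary fields (`exists_eLpNorm_divGlue_le`). So `u` may be replaced by a simple
function, with no condition on its divergence or normal trace. The smoothed simple function is a
finite sum of scalar smooth functions times vectors of `F`, so it has values in `F` itself and keeps
every linear constraint on the values. This is `exists_finite_rank_approx`; both density statements
follow from it through `exists_smooth_approx`.

The inclusions come from Green's formula on the box (`normalTraceZeroOff_of_mem_CcInfty`). On each
face either the field vanishes or the boundary values of the functions approximating the test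
function tend to zero in `L²`. -/

theorem isOpen_box {d : ℕ} (a b : Fin d → ℝ) : IsOpen (box a b) := by
  have h : box a b = ⋂ i, (fun x : E d => x i) ⁻¹' Ioo (a i) (b i) := by
    ext x; simp [box]
  rw [h]
  exact isOpen_iInter_of_finite fun i => isOpen_Ioo.preimage (by fun_prop)

theorem closure_box {d : ℕ} {a b : Fin d → ℝ} (hab : ∀ i, a i < b i) :
    closure (box a b) = {x : E d | ∀ i, x i ∈ Icc (a i) (b i)} := by
  have h : box a b =
      (PiLp.homeomorph 2 fun _ : Fin d => ℝ) ⁻¹' univ.pi fun i => Ioo (a i) (b i) := by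
    ext x; simp [box, PiLp.homeomorph]
  rw [h, ← Homeomorph.preimage_closure, closure_pi_set]
  ext x
  simp [PiLp.homeomorph, closure_Ioo (hab _).ne, Pi.le_def, forall_and]

theorem isBounded_box {d : ℕ} (a b : Fin d → ℝ) :
    Bornology.IsBounded (box a b) := by
  have h : IsCompact
      ((PiLp.homeomorph 2 fun _ : Fin d => ℝ) ⁻¹' univ.pi fun i => Icc (a i) (b i)) :=
    (Homeomorph.isCompact_preimage _).2 (isCompact_univ_pi fun i => isCompact_Icc)
  refine h.isBounded.subset fun x hx i _ => ?_
  exact Ioo_subset_Icc_self (hx i)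

theorem isCompact_closure_box {d : ℕ} (a b : Fin d → ℝ) :
    IsCompact (closure (box a b)) := (isBounded_box a b).isCompact_closure

instance isFiniteMeasure_restrict_box {d : ℕ} (a b : Fin d → ℝ) :
    IsFiniteMeasure ((volume : Measure (E d)).restrict (box a b)) := by
  refine ⟨?_⟩
  rw [Measure.restrict_apply_univ]
  exact (isBounded_box a b).measure_lt_top

theorem mem_frontier_box {d : ℕ} {a b : Fin d → ℝ} (hab : ∀ i, a i < b i) {x : E d} :
    x ∈ frontier (box a b) ↔ (∀ i, x i ∈ Icc (a i) (b i)) ∧ ∃ i, x i = a i ∨ x i = b i := by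
  rw [(isOpen_box a b).frontier_eq, closure_box hab]
  constructor
  · rintro ⟨h1, h2⟩
    refine ⟨h1, ?_⟩
    by_contra! h3
    exact h2 fun i => ⟨lt_of_le_of_ne (h1 i).1 (h3 i).1.symm, lt_of_le_of_ne (h1 i).2 (h3 i).2⟩
  · rintro ⟨h1, i, h2⟩
    refine ⟨h1, fun h3 => ?_⟩
    rcases h2 with h2 | h2
    · exact (h3 i).1.ne' h2
    · exact (h3 i).2.ne h2

/-- The closure of `∂_D Σ` is contained in the union of its closed faces. -/
theorem closure_bdryD_subset {d : ℕ} (a b : Fin d → ℝ) (Ia Ib : Set (Fin d)) :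
    closure (bdryD a b Ia Ib) ⊆ {x | (∃ i ∈ Ia, x i = a i) ∨ ∃ i ∈ Ib, x i = b i} := by
  refine closure_minimal ?_ ?_
  · rintro x ⟨hx, -⟩
    rcases hx with hx | hx
    · simp only [mem_iUnion] at hx
      obtain ⟨i, hi, -, h⟩ := hx
      exact Or.inl ⟨i, hi, h⟩
    · simp only [mem_iUnion] at hx
      obtain ⟨i, hi, -, h⟩ := hx
      exact Or.inr ⟨i, hi, h⟩
  · have h : {x : E d | (∃ i ∈ Ia, x i = a i) ∨ ∃ i ∈ Ib, x i = b i} =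
        (⋃ i ∈ Ia, {x : E d | x i = a i}) ∪ ⋃ i ∈ Ib, {x : E d | x i = b i} := by
      ext x; simp
    rw [h]
    exact (Set.Finite.isClosed_biUnion (toFinite Ia) fun i _ =>
        isClosed_eq (by fun_prop) continuous_const).union
      (Set.Finite.isClosed_biUnion (toFinite Ib) fun i _ =>
        isClosed_eq (by fun_prop) continuous_const)

/-- Avoiding the finitely many closed faces outside `∂_D Σ` is an open condition, and a boundary
point that avoids them lies on a face from the prescribed union. -/
theorem mem_bdryD_of_forall {d : ℕ} {a b : Fin d → ℝ} (hab : ∀ i, a i < b i) {Ia Ib : Set (Fin d)}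
    {x : E d} (hx : x ∈ frontier (box a b)) (ha : ∀ i, x i = a i → i ∈ Ia)
    (hb : ∀ i, x i = b i → i ∈ Ib) : x ∈ bdryD a b Ia Ib := by
  have key : ∀ z ∈ frontier (box a b), (∀ i, z i = a i → i ∈ Ia) → (∀ i, z i = b i → i ∈ Ib) →
      z ∈ (⋃ i ∈ Ia, {x | x ∈ frontier (box a b) ∧ x i = a i}) ∪
        ⋃ i ∈ Ib, {x | x ∈ frontier (box a b) ∧ x i = b i} := by
    intro z hz h1 h2
    obtain ⟨-, i, h | h⟩ := (mem_frontier_box hab).1 hz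
    · exact Or.inl (mem_iUnion₂.2 ⟨i, h1 i h, hz, h⟩)
    · exact Or.inr (mem_iUnion₂.2 ⟨i, h2 i h, hz, h⟩)
  refine ⟨key x hx ha hb, {z | (∀ i, i ∉ Ia → z i ≠ a i) ∧ ∀ i, i ∉ Ib → z i ≠ b i}, ?_, ?_, ?_⟩
  · have h : {z : E d | (∀ i, i ∉ Ia → z i ≠ a i) ∧ ∀ i, i ∉ Ib → z i ≠ b i} =
        ⋂ i, {z : E d | i ∉ Ia → z i ≠ a i} ∩ {z : E d | i ∉ Ib → z i ≠ b i} := by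
      ext z; simp [forall_and]
    rw [h]
    refine isOpen_iInter_of_finite fun i => ?_
    refine IsOpen.inter ?_ ?_
    · by_cases hi : i ∈ Ia
      · simp [hi]
      · simpa [hi] using isOpen_ne_fun (f := fun z : E d => z i) (by fun_prop) continuous_const
    · by_cases hi : i ∈ Ib
      · simp [hi]
      · simpa [hi] using isOpen_ne_fun (f := fun z : E d => z i) (by fun_prop) continuous_const
  · exact ⟨fun i hi h => hi (ha i h), fun i hi h => hi (hb i h)⟩
  · rintro z ⟨⟨h1, h2⟩, hz⟩
    exact key z hz (fun i h => by_contra fun hi => h1 i hi h)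
      (fun i h => by_contra fun hi => h2 i hi h)

theorem exists_of_mem_bdryN {d : ℕ} {a b : Fin d → ℝ} (hab : ∀ i, a i < b i) {Ia Ib : Set (Fin d)}
    {x : E d} (hx : x ∈ bdryN a b Ia Ib) :
    (∃ i, i ∉ Ia ∧ x i = a i) ∨ ∃ i, i ∉ Ib ∧ x i = b i := by
  by_contra! h
  exact hx.1.2 (mem_bdryD_of_forall hab hx.1.1 (fun i hi => by_contra fun h' => h.1 i h' hi)
    (fun i hi => by_contra fun h' => h.2 i h' hi))

/-- Points on the relatively open upper face with index `i ∉ Ib`, or lower face with `i ∉ Ia`,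
belong to `∂_N Σ`. -/
theorem mem_bdryN_of_face {d : ℕ} {a b : Fin d → ℝ} (hab : ∀ i, a i < b i) {Ia Ib : Set (Fin d)}
    {x : E d} {i : Fin d} (hj : ∀ j, j ≠ i → x j ∈ Ioo (a j) (b j))
    (hi : (x i = a i ∧ i ∉ Ia) ∨ (x i = b i ∧ i ∉ Ib)) : x ∈ bdryN a b Ia Ib := by
  let V : Set (E d) := {z | (∀ j, j ≠ i → z j ∈ Ioo (a j) (b j)) ∧
    (i ∈ Ia → z i ≠ a i) ∧ (i ∈ Ib → z i ≠ b i)}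
  have key : ∀ z ∈ V, z ∉ bdryD a b Ia Ib := by
    rintro z ⟨h1, h2, h3⟩ hz
    rcases closure_bdryD_subset a b Ia Ib (subset_closure hz) with ⟨j, hj', h⟩ | ⟨j, hj', h⟩
    · by_cases hji : j = i
      · subst hji; exact h2 hj' h
      · exact (h1 j hji).1.ne' h
    · by_cases hji : j = i
      · subst hji; exact h3 hj' h
      · exact (h1 j hji).2.ne h
  have hxV : x ∈ V := by
    refine ⟨hj, fun h h' => ?_, fun h h' => ?_⟩
    · rcases hi with hi | hi
      · exact hi.2 h
      · exact (hab i).ne (h'.symm.trans hi.1)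
    · rcases hi with hi | hi
      · exact (hab i).ne (hi.1.symm.trans h')
      · exact hi.2 h
  have hxf : x ∈ frontier (box a b) := by
    refine (mem_frontier_box hab).2 ⟨fun j => ?_, i, hi.imp And.left And.left⟩
    by_cases h : j = i
    · subst h
      rcases hi with hi | hi
      · rw [hi.1]; exact left_mem_Icc.2 (hab j).le
      · rw [hi.1]; exact right_mem_Icc.2 (hab j).le
    · exact Ioo_subset_Icc_self (hj j h)
  refine ⟨⟨hxf, key x hxV⟩, V, ?_, hxV, fun z hz => ⟨hz.2, key z hz.1⟩⟩
  have h : V = (⋂ j, {z : E d | j ≠ i → z j ∈ Ioo (a j) (b j)}) ∩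
      ({z : E d | i ∈ Ia → z i ≠ a i} ∩ {z : E d | i ∈ Ib → z i ≠ b i}) := by
    ext z; simp [V]
  rw [h]
  refine (isOpen_iInter_of_finite fun j => ?_).inter (IsOpen.inter ?_ ?_)
  · by_cases h : j = i
    · simp [h]
    · simpa [h, preimage] using
        isOpen_Ioo (a := a j) (b := b j) |>.preimage (f := fun z : E d => z j) (by fun_prop)
  · by_cases hi : i ∈ Ia
    · simpa [hi] using isOpen_ne_fun (f := fun z : E d => z i) (by fun_prop) continuous_const
    · simp [hi]
  · by_cases hi : i ∈ Ib
    · simpa [hi] using isOpen_ne_fun (f := fun z : E d => z i) (by fun_prop) continuous_const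
    · simp [hi]

theorem mem_bdryD_of_face {d : ℕ} {a b : Fin d → ℝ} (hab : ∀ i, a i < b i) {Ia Ib : Set (Fin d)}
    {x : E d} {i : Fin d} (hj : ∀ j, j ≠ i → x j ∈ Ioo (a j) (b j))
    (hi : (x i = a i ∧ i ∈ Ia) ∨ (x i = b i ∧ i ∈ Ib)) : x ∈ bdryD a b Ia Ib := by
  have hxf : x ∈ frontier (box a b) := by
    refine (mem_frontier_box hab).2 ⟨fun j => ?_, i, hi.imp And.left And.left⟩
    by_cases h : j = i
    · subst h
      rcases hi with hi | hi
      · rw [hi.1]; exact left_mem_Icc.2 (hab j).le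
      · rw [hi.1]; exact right_mem_Icc.2 (hab j).le
    · exact Ioo_subset_Icc_self (hj j h)
  refine mem_bdryD_of_forall hab hxf (fun j h => ?_) (fun j h => ?_)
  · by_cases hji : j = i
    · subst hji
      rcases hi with hi | hi
      · exact hi.2
      · exact absurd (h.symm.trans hi.1) (hab j).ne
    · exact absurd h (hj j hji).1.ne'
  · by_cases hji : j = i
    · subst hji
      rcases hi with hi | hi
      · exact absurd (hi.1.symm.trans h) (hab j).ne
      · exact hi.2
    · exact absurd h (hj j hji).2.ne

/-! ### Weak divergence of smooth fields and uniqueness -/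

theorem memLp_box_of_continuous {d : ℕ} (a b : Fin d → ℝ) {G : Type*} [NormedAddCommGroup G]
    {f : E d → G} (hf : Continuous f) (p : ℝ≥0∞) : MemLp f p (volume.restrict (box a b)) := by
  obtain ⟨C, hC⟩ := (isCompact_closure_box a b).exists_bound_of_continuousOn hf.continuousOn
  refine MemLp.of_bound hf.aestronglyMeasurable C ?_
  filter_upwards [ae_restrict_mem (isOpen_box a b).measurableSet] with x hx
  exact hC x (subset_closure hx)

theorem continuous_fderiv_basisVec {m : ℕ} {f : E m → ℝ} (hf : ContDiff ℝ ∞ f) (i : Fin m) :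
    Continuous fun x => fderiv ℝ f x (basisVec i) :=
  continuous_jet hf (some i)

theorem setIntegral_mul_fderiv_test {m : ℕ} {O : Set (E m)} {f φ : E m → ℝ}
    (hf : ContDiff ℝ ∞ f) (hφ : IsTestFun O φ) (i : Fin m) :
    ∫ x in O, f x * fderiv ℝ φ x (basisVec i) = -∫ x in O, fderiv ℝ f x (basisVec i) * φ x := by
  have hzero : ∀ x, x ∉ O → φ x = 0 := fun x hx =>
    image_eq_zero_of_notMem_tsupport fun h => hx (hφ.supp h)
  have hzero' : ∀ x, x ∉ O → fderiv ℝ φ x = 0 := fun x hx =>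
    image_eq_zero_of_notMem_tsupport fun h => hx (hφ.supp (tsupport_fderiv_subset ℝ h))
  have hφ' : HasCompactSupport fun x => fderiv ℝ φ x (basisVec i) :=
    hφ.compact.fderiv_apply (𝕜 := ℝ) _
  rw [setIntegral_eq_integral_of_forall_compl_eq_zero fun x hx => by simp [hzero' x hx],
    setIntegral_eq_integral_of_forall_compl_eq_zero fun x hx => by simp [hzero x hx]]
  refine integral_mul_fderiv_eq_neg_fderiv_mul_of_integrable ?_ ?_ ?_ ?_ ?_
  · exact ((continuous_fderiv_basisVec hf i).mul
      hφ.smooth.continuous).integrable_of_hasCompactSupport hφ.compact.mul_left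
  · exact (hf.continuous.mul
      (continuous_fderiv_basisVec hφ.smooth i)).integrable_of_hasCompactSupport hφ'.mul_left
  · exact (hf.continuous.mul hφ.smooth.continuous).integrable_of_hasCompactSupport
      hφ.compact.mul_left
  · exact fun x _ => hf.differentiable (by simp) x
  · exact fun x _ => hφ.smooth.differentiable (by simp) x

theorem isWeakDiv_of_contDiff {d : ℕ} (a b : Fin d → ℝ) {w : Fin d → E d → ℝ}
    (hw : ∀ i, ContDiff ℝ ∞ (w i)) :
    IsWeakDiv (box a b) w fun x => ∑ i, fderiv ℝ (w i) x (basisVec i) := by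
  refine ⟨memLp_box_of_continuous a b
    (continuous_finsetSum _ fun i _ => continuous_fderiv_basisVec (hw i) i) 2, fun φ hφ => ?_⟩
  have h1 : ∀ i, Integrable (fun x => w i x * jet φ (some i) x) (volume.restrict (box a b)) :=
    fun i => (memLp_box_of_continuous a b (hw i).continuous 2).integrable_mul (hφ.memLp_jet _)
  have h2 : ∀ i, Integrable (fun x => fderiv ℝ (w i) x (basisVec i) * φ x)
      (volume.restrict (box a b)) := fun i =>
    (memLp_box_of_continuous a b (continuous_fderiv_basisVec (hw i) i) 2).integrable_mul
      (hφ.memLp_jet none)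
  simp_rw [Finset.sum_mul]
  rw [integral_finsetSum _ fun i _ => h1 i, integral_finsetSum _ fun i _ => h2 i,
    ← Finset.sum_neg_distrib]
  exact Finset.sum_congr rfl fun i _ => setIntegral_mul_fderiv_test (hw i) hφ i

/-- This is the fundamental lemma of the calculus of variations. It allows the chosen representative
`weakDiv` to be replaced by any explicit weak divergence. -/
theorem IsWeakDiv.ae_eq {d : ℕ} {S : Set (E d)} (hS : IsOpen S) {w : Fin d → E d → ℝ}
    {g g' : E d → ℝ} (h : IsWeakDiv S w g) (h' : IsWeakDiv S w g') :
    g =ᵐ[volume.restrict S] g' := by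
  have hsub : MemLp (fun x => g x - g' x) 2 (volume.restrict S) := h.1.sub h'.1
  have key := hS.ae_eq_zero_of_integral_contDiff_smul_eq_zero (μ := volume)
    (f := fun x => g x - g' x) ?_ ?_
  · rw [EventuallyEq, ae_restrict_iff' hS.measurableSet]
    filter_upwards [key] with x hx hxS
    exact sub_eq_zero.1 (hx hxS)
  · refine (locallyIntegrableOn_of_locallyIntegrable_restrict ?_)
    exact hsub.locallyIntegrable (by norm_num)
  · intro φ hφ hc hs
    have ht : IsTestFun S φ := ⟨hφ, hc, hs⟩
    have hi : ∀ {f : E d → ℝ}, MemLp f 2 (volume.restrict S) →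
        Integrable (fun x => f x * φ x) (volume.restrict S) := fun hf =>
      hf.integrable_mul (ht.memLp_jet none)
    rw [← setIntegral_eq_integral_of_forall_compl_eq_zero (s := S) fun x hx => by
      simp [image_eq_zero_of_notMem_tsupport fun h => hx (hs h)]]
    have e : ∀ x, φ x • (g x - g' x) = g x * φ x - g' x * φ x := fun x => by
      rw [smul_eq_mul]; ring
    simp_rw [e]
    rw [integral_sub (hi h.1) (hi h'.1)]
    linarith [h.2 φ ht, h'.2 φ ht]

theorem isWeakDiv_weakDiv {d : ℕ} {S : Set (E d)} {w : Fin d → E d → ℝ} (h : HasL2Div S w) :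
    IsWeakDiv S w (weakDiv S w) := by
  rw [weakDiv, dif_pos h]
  exact h.choose_spec

theorem IsWeakDiv.weakDiv_ae_eq {d : ℕ} {S : Set (E d)} (hS : IsOpen S) {w : Fin d → E d → ℝ}
    {g : E d → ℝ} (h : IsWeakDiv S w g) : weakDiv S w =ᵐ[volume.restrict S] g :=
  (isWeakDiv_weakDiv ⟨g, h⟩).ae_eq hS h

theorem IsWeakDiv.sub {d : ℕ} {S : Set (E d)} {w w' : Fin d → E d → ℝ} {g g' : E d → ℝ}
    (hw : ∀ i, MemLp (w i) 2 (volume.restrict S)) (hw' : ∀ i, MemLp (w' i) 2 (volume.restrict S))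
    (h : IsWeakDiv S w g) (h' : IsWeakDiv S w' g') : IsWeakDiv S (w - w') (g - g') := by
  refine ⟨h.1.sub h'.1, fun φ hφ => ?_⟩
  have i1 : ∀ {w : Fin d → E d → ℝ}, (∀ i, MemLp (w i) 2 (volume.restrict S)) →
      Integrable (fun x => ∑ i, w i x * jet φ (some i) x) (volume.restrict S) := fun hw =>
    integrable_finsetSum _ fun i _ => (hw i).integrable_mul (hφ.memLp_jet _)
  have i2 : ∀ {g : E d → ℝ}, MemLp g 2 (volume.restrict S) →
      Integrable (fun x => g x * φ x) (volume.restrict S) := fun hg =>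
    hg.integrable_mul (hφ.memLp_jet none)
  simp only [Pi.sub_apply, sub_mul, Finset.sum_sub_distrib]
  rw [integral_sub (i1 hw) (i1 hw'), integral_sub (i2 h.1) (i2 h'.1), h.2 φ hφ, h'.2 φ hφ]
  ring

/-- The element of `L2Jet Σ` given by a smooth function. -/
def smoothJet {d : ℕ} (a b : Fin d → ℝ) {φ : E d → ℝ} (hφ : ContDiff ℝ ∞ φ) : L2Jet (box a b) :=
  WithLp.toLp 2 fun k => (memLp_box_of_continuous a b (continuous_jet hφ k) 2).toLp (jet φ k)

theorem smoothJet_ae_eq {d : ℕ} (a b : Fin d → ℝ) {φ : E d → ℝ} (hφ : ContDiff ℝ ∞ φ)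
    (k : Option (Fin d)) : smoothJet a b hφ k =ᵐ[volume.restrict (box a b)] jet φ k :=
  (memLp_box_of_continuous a b (continuous_jet hφ k) 2).coeFn_toLp

/-- The constant sequence `φ` itself witnesses the vanishing trace. -/
theorem smoothJet_mem_H1Zero {d : ℕ} (a b : Fin d → ℝ) {φ : E d → ℝ} (hφ : ContDiff ℝ ∞ φ)
    {N : Set (E d)} (hN : ∀ x ∈ N, φ x = 0) : smoothJet a b hφ ∈ H1Zero (box a b) N := by
  refine ⟨fun ψ hψ i => ?_, fun _ => φ, fun _ => hφ, fun j => ?_, ?_⟩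
  · have h1 : ∫ x in box a b, smoothJet a b hφ none x * jet ψ (some i) x =
        ∫ x in box a b, φ x * fderiv ℝ ψ x (basisVec i) := by
      refine integral_congr_ae ?_
      filter_upwards [smoothJet_ae_eq a b hφ none] with x hx
      rw [hx]; rfl
    have h2 : ∫ x in box a b, smoothJet a b hφ (some i) x * ψ x =
        ∫ x in box a b, fderiv ℝ φ x (basisVec i) * ψ x := by
      refine integral_congr_ae ?_
      filter_upwards [smoothJet_ae_eq a b hφ (some i)] with x hx
      rw [hx]; rfl
    rw [h1, h2]
    exact setIntegral_mul_fderiv_test hφ hψ i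
  · have h0 : eLpNorm (jet φ j - (smoothJet a b hφ j : E d → ℝ)) 2
        (volume.restrict (box a b)) = 0 := by
      rw [← eLpNorm_zero (α := E d) (ε := ℝ) (p := 2) (μ := volume.restrict (box a b))]
      refine eLpNorm_congr_ae ?_
      filter_upwards [smoothJet_ae_eq a b hφ j] with x hx
      simp [hx]
    simp only [h0]
    exact tendsto_const_nhds
  · have h0 : eLpNorm φ 2 ((μH[(d : ℝ) - 1] : Measure (E d)).restrict N) = 0 := by
      rw [← eLpNorm_zero (α := E d) (ε := ℝ) (p := 2)
        (μ := (μH[(d : ℝ) - 1] : Measure (E d)).restrict N)]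
      refine eLpNorm_congr_ae ?_
      rw [EventuallyEq, ae_iff]
      -- The set `{φ ≠ 0}` is open, hence measurable, so its measure under the restriction to `N`
      -- can be computed without measurability of `N`.
      have ho : IsOpen {x | ¬ φ x = (0 : E d → ℝ) x} := isOpen_ne_fun hφ.continuous continuous_const
      rw [Measure.restrict_apply ho.measurableSet]
      convert measure_empty (μ := (μH[(d : ℝ) - 1] : Measure (E d)))
      ext x
      simp only [mem_inter_iff, mem_ofPred_eq, mem_empty_iff_false, iff_false, not_and]
      exact fun h1 h2 => h1 (hN x h2)
    simp only [h0]
    exact tendsto_const_nhds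

/-- A field with vanishing normal trace off `N` satisfies Green's formula without boundary terms
against smooth functions that vanish on `N`. -/
theorem NormalTraceZeroOff.integral_smooth {d : ℕ} {a b : Fin d → ℝ} {N : Set (E d)}
    {w : Fin d → E d → ℝ} (h : NormalTraceZeroOff (box a b) N w) {φ : E d → ℝ}
    (hφ : ContDiff ℝ ∞ φ) (hN : ∀ x ∈ N, φ x = 0) :
    ∫ x in box a b,
      ((∑ i, w i x * fderiv ℝ φ x (basisVec i)) + weakDiv (box a b) w x * φ x) = 0 := by
  rw [← h _ (smoothJet_mem_H1Zero a b hφ hN)]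
  refine integral_congr_ae ?_
  have hs : ∀ᵐ x ∂(volume.restrict (box a b)), ∀ k, smoothJet a b hφ k x = jet φ k x :=
    ae_all_iff.2 fun k => smoothJet_ae_eq a b hφ k
  filter_upwards [hs] with x hx
  simp only [hx]
  rfl

/-! ### Green's formula for smooth fields -/

theorem integrable_mul_of_memLp {α : Type*} [MeasurableSpace α] {ν : Measure α} {f g : α → ℝ}
    (hf : MemLp f 2 ν) (hg : MemLp g 2 ν) : Integrable (fun x => f x * g x) ν :=
  hf.integrable_mul hg

theorem tendsto_integral_mul_zero {α : Type*} [MeasurableSpace α] {ν : Measure α} {f : α → ℝ}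
    (hf : MemLp f 2 ν) {g : ℕ → α → ℝ} (hg : ∀ k, AEStronglyMeasurable (g k) ν)
    (h : Tendsto (fun k => eLpNorm (g k) 2 ν) atTop (𝓝 0)) :
    Tendsto (fun k => ∫ x, f x * g k x ∂ν) atTop (𝓝 0) := by
  rw [tendsto_zero_iff_enorm_tendsto_zero]
  have h2 := ENNReal.Tendsto.const_mul (a := eLpNorm f 2 ν) h (Or.inr hf.2.ne)
  rw [mul_zero] at h2
  refine tendsto_of_tendsto_of_tendsto_of_le_of_le tendsto_const_nhds h2 (fun _ => zero_le)
    fun k => ?_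
  refine (enorm_integral_le_lintegral_enorm _).trans ?_
  have h3 : eLpNorm (f • g k) 1 ν ≤ eLpNorm f 2 ν * eLpNorm (g k) 2 ν :=
    eLpNorm_smul_le_mul_eLpNorm (hg k) hf.1
  rwa [eLpNorm_one_eq_lintegral_enorm] at h3

/-- The parametrization of the hyperplane `x_i = c` of `ℝ^{n+1}` by the other coordinates. -/
def faceMap {n : ℕ} (i : Fin (n + 1)) (c : ℝ) (y : Fin n → ℝ) : E (n + 1) :=
  WithLp.toLp 2 (i.insertNth c y : Fin (n + 1) → ℝ)

theorem faceMap_same {n : ℕ} (i : Fin (n + 1)) (c : ℝ) (y : Fin n → ℝ) :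
    faceMap i c y i = c := by simp [faceMap]

theorem faceMap_succAbove {n : ℕ} (i : Fin (n + 1)) (c : ℝ) (y : Fin n → ℝ) (j : Fin n) :
    faceMap i c y (i.succAbove j) = y j := by simp [faceMap]

theorem continuous_faceMap {n : ℕ} (i : Fin (n + 1)) (c : ℝ) : Continuous (faceMap i c) := by
  refine (PiLp.continuous_toLp 2 _).comp (continuous_pi fun j => ?_)
  rcases Fin.eq_self_or_eq_succAbove i j with rfl | ⟨k, rfl⟩
  · simpa using continuous_const
  · simpa using continuous_apply k

/-- On a part `Q` of a hyperplane, the Lebesgue measure of the parametrization is dominated by the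
surface measure. -/
theorem map_faceMap_le {n : ℕ} (i : Fin (n + 1)) (c : ℝ) {Q : Set (Fin n → ℝ)} {N : Set (E (n + 1))}
    (hQN : ∀ y ∈ Q, faceMap i c y ∈ N) :
    (volume.restrict Q).map (faceMap i c) ≤
      (μH[((n + 1 : ℕ) : ℝ) - 1] : Measure (E (n + 1))).restrict N := by
  have hc := continuous_faceMap i c
  refine Measure.le_iff.2 fun S hS => ?_
  rw [Measure.map_apply hc.measurable hS, Measure.restrict_apply (hc.measurable hS),
    Measure.restrict_apply hS]
  -- Dropping the coordinate `i` is a 1-Lipschitz left inverse of `faceMap`, so it does not increase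
  -- the Hausdorff measure; on `Fin n → ℝ` with the supremum norm that measure is Lebesgue measure.
  -- One inequality suffices, so the constant relating the two measures on the hyperplane plays no
  -- role.
  let p : E (n + 1) → Fin n → ℝ := fun x j => x (i.succAbove j)
  have hp : LipschitzWith 1 p := by
    refine LipschitzWith.of_dist_le_mul fun x y => ?_
    rw [NNReal.coe_one, one_mul, dist_pi_le_iff dist_nonneg]
    intro j
    simpa [Real.dist_eq, dist_eq_norm] using PiLp.norm_apply_le (x - y) (i.succAbove j)
  have e : p '' (faceMap i c '' (faceMap i c ⁻¹' S ∩ Q)) = faceMap i c ⁻¹' S ∩ Q := by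
    have hid : (fun y => p (faceMap i c y)) = id :=
      funext fun y => funext fun j => faceMap_succAbove i c y j
    rw [image_image, hid, image_id]
  have hd : ((n + 1 : ℕ) : ℝ) - 1 = (Fintype.card (Fin n) : ℕ) := by simp
  rw [hd, ← e, ← hausdorffMeasure_pi_real]
  refine (hp.hausdorffMeasure_image_le (Nat.cast_nonneg _) _).trans ?_
  rw [ENNReal.coe_one, ENNReal.one_rpow, one_mul]
  refine measure_mono ?_
  rintro _ ⟨y, ⟨h1, h2⟩, rfl⟩
  exact ⟨h1, hQN y h2⟩

/-- The boundary terms of Green's formula. -/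
theorem tendsto_face_integral {n : ℕ} {a b : Fin (n + 1) → ℝ} (hab : ∀ i, a i < b i)
    {Ia Ib : Set (Fin (n + 1))} {w : E (n + 1) → ℝ}
    (hw : w ∈ CcInfty (box a b) (bdryD a b Ia Ib) ℝ) {φ : ℕ → E (n + 1) → ℝ}
    (hφ : ∀ k, Continuous (φ k))
    (hlim : Tendsto (fun k => eLpNorm (φ k) 2
      ((μH[((n + 1 : ℕ) : ℝ) - 1] : Measure (E (n + 1))).restrict (bdryN a b Ia Ib))) atTop (𝓝 0))
    (i : Fin (n + 1)) {c : ℝ} (hc : c = a i ∨ c = b i) :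
    Tendsto (fun k => ∫ y in Icc (a ∘ i.succAbove) (b ∘ i.succAbove),
      w (faceMap i c y) * φ k (faceMap i c y)) atTop (𝓝 0) := by
  have hQ : (univ.pi fun j => Ioo ((a ∘ i.succAbove) j) ((b ∘ i.succAbove) j)) =ᵐ[volume]
      Icc (a ∘ i.succAbove) (b ∘ i.succAbove) := Measure.univ_pi_Ioo_ae_eq_Icc
  set Q := univ.pi fun j => Ioo ((a ∘ i.succAbove) j) ((b ∘ i.succAbove) j) with hQdef
  have hQm : MeasurableSet Q := MeasurableSet.univ_pi fun _ => measurableSet_Ioo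
  -- Only points in the relative interior of a face are known to lie in `∂_D Σ` or `∂_N Σ`; the
  -- edges that are discarded form a null set.
  simp_rw [← setIntegral_congr_set hQ]
  have hface : ∀ y ∈ Q, ∀ j, j ≠ i → faceMap i c y j ∈ Ioo (a j) (b j) := by
    intro y hy j hj
    obtain ⟨k, rfl⟩ := Fin.exists_succAbove_eq hj
    rw [faceMap_succAbove]
    exact hy k (mem_univ _)
  -- On a face of `∂_D Σ` the field `w` is zero. On any other face `φ k` tends to zero in `L²`, and
  -- `w` is bounded.
  by_cases hD : (c = a i ∧ i ∈ Ia) ∨ (c = b i ∧ i ∈ Ib)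
  · have h0 : ∀ k, ∫ y in Q, w (faceMap i c y) * φ k (faceMap i c y) = 0 := by
      intro k
      refine setIntegral_eq_zero_of_forall_eq_zero fun y hy => ?_
      have hyD : faceMap i c y ∈ bdryD a b Ia Ib :=
        mem_bdryD_of_face hab (hface y hy) (by simpa only [faceMap_same] using hD)
      have hcl : faceMap i c y ∈ closure (box a b) := by
        rcases hyD.1 with h | h <;>
        · simp only [mem_iUnion] at h
          obtain ⟨_, _, h, _⟩ := h
          exact frontier_subset_closure h
      have : w (faceMap i c y) = 0 := by
        by_contra hne
        exact (hw.2 (subset_closure ⟨hcl, hne⟩)).2 hyD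
      rw [this, zero_mul]
    simp only [h0]
    exact tendsto_const_nhds
  · have hN : ∀ y ∈ Q, faceMap i c y ∈ bdryN a b Ia Ib := by
      intro y hy
      refine mem_bdryN_of_face hab (hface y hy) ?_
      simp only [faceMap_same]
      tauto
    have hcont := continuous_faceMap i c
    refine tendsto_integral_mul_zero (f := fun y => w (faceMap i c y))
      (g := fun k y => φ k (faceMap i c y)) ?_
      (fun k => ((hφ k).comp hcont).aestronglyMeasurable) ?_
    · have hfin : IsFiniteMeasure ((volume : Measure (Fin n → ℝ)).restrict Q) := by
        refine ⟨?_⟩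
        rw [Measure.restrict_apply_univ, measure_congr hQ]
        exact isCompact_Icc.measure_lt_top
      have hwc : Continuous fun y => w (faceMap i c y) := hw.1.continuous.comp hcont
      obtain ⟨C, hC⟩ := (isCompact_Icc (a := a ∘ i.succAbove)
        (b := b ∘ i.succAbove)).exists_bound_of_continuousOn hwc.continuousOn
      refine MemLp.of_bound hwc.aestronglyMeasurable C ?_
      filter_upwards [ae_restrict_mem hQm] with y hy
      refine hC y ?_
      rw [← pi_univ_Icc]
      exact fun j hj => Ioo_subset_Icc_self (hy j hj)
    · refine tendsto_of_tendsto_of_tendsto_of_le_of_le tendsto_const_nhds hlim (fun _ => zero_le)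
        fun k => ?_
      have := eLpNorm_map_measure (μ := volume.restrict Q) (p := 2) (g := φ k)
        (f := faceMap i c) (hφ k).aestronglyMeasurable hcont.measurable.aemeasurable
      refine (le_of_eq this.symm).trans (eLpNorm_mono_measure _ (map_faceMap_le i c hN))

/-- The divergence theorem on the box, for a product of smooth functions. -/
theorem integral_box_green {n : ℕ} {a b : Fin (n + 1) → ℝ} (hab : ∀ i, a i < b i)
    {w : Fin (n + 1) → E (n + 1) → ℝ} (hw : ∀ i, ContDiff ℝ ∞ (w i)) {φ : E (n + 1) → ℝ}
    (hφ : ContDiff ℝ ∞ φ) :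
    ∫ x in box a b, ((∑ i, w i x * fderiv ℝ φ x (basisVec i)) +
        (∑ i, fderiv ℝ (w i) x (basisVec i)) * φ x) =
      ∑ i, ((∫ y in Icc (a ∘ i.succAbove) (b ∘ i.succAbove),
          w i (faceMap i (b i) y) * φ (faceMap i (b i) y)) -
        ∫ y in Icc (a ∘ i.succAbove) (b ∘ i.succAbove),
          w i (faceMap i (a i) y) * φ (faceMap i (a i) y)) := by
  -- In plain coordinates the closed box is an order interval, and the divergence theorem applies to
  -- `w i * φ` with an empty exceptional set.
  let L : (Fin (n + 1) → ℝ) ≃L[ℝ] E (n + 1) := (EuclideanSpace.equiv (Fin (n + 1)) ℝ).symm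
  let f' : Fin (n + 1) → (Fin (n + 1) → ℝ) → ((Fin (n + 1) → ℝ) →L[ℝ] ℝ) := fun i x =>
    (w i (L x) • fderiv ℝ φ (L x) + φ (L x) • fderiv ℝ (w i) (L x)).comp
      (L : (Fin (n + 1) → ℝ) →L[ℝ] E (n + 1))
  have hd : ∀ x i, HasFDerivAt (fun x => w i (L x) * φ (L x)) (f' i x) x := fun x i =>
    ((((hw i).differentiable (by simp) (L x)).hasFDerivAt).mul
      ((hφ.differentiable (by simp) (L x)).hasFDerivAt)).comp x L.hasFDerivAt
  have hs : ∀ i, L (Pi.single i 1) = basisVec i := fun i => by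
    ext j; simp [L]
  have hval : ∀ x, ∑ i, f' i x (Pi.single i 1) =
      (∑ i, w i (L x) * fderiv ℝ φ (L x) (basisVec i)) +
        (∑ i, fderiv ℝ (w i) (L x) (basisVec i)) * φ (L x) := by
    intro x
    rw [Finset.sum_mul, ← Finset.sum_add_distrib]
    refine Finset.sum_congr rfl fun i _ => ?_
    simp only [f', ContinuousLinearMap.comp_apply, ContinuousLinearEquiv.coe_coe, hs,
      _root_.add_apply, _root_.smul_apply, smul_eq_mul]
    ring
  have hcont : Continuous fun x => (∑ i, w i x * fderiv ℝ φ x (basisVec i)) +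
        (∑ i, fderiv ℝ (w i) x (basisVec i)) * φ x := by
    refine (continuous_finsetSum _ fun i _ => ?_).add
      ((continuous_finsetSum _ fun i _ => ?_).mul hφ.continuous)
    · exact (hw i).continuous.mul (continuous_fderiv_basisVec hφ i)
    · exact continuous_fderiv_basisVec (hw i) i
  have key := integral_divergence_of_hasFDerivAt_off_countable' a b (fun i => (hab i).le)
    (fun i x => w i (L x) * φ (L x)) f' ∅ countable_empty
    (fun i => (continuous_iff_continuousAt.2 fun x => (hd x i).continuousAt).continuousOn)
    (fun x _ i => hd x i) (by
      simp_rw [hval]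
      exact (hcont.comp L.continuous).continuousOn.integrableOn_compact isCompact_Icc)
  simp_rw [hval] at key
  refine Eq.trans ?_ key
  have hQ : (univ.pi fun j => Ioo (a j) (b j)) =ᵐ[volume] Icc a b := Measure.univ_pi_Ioo_ae_eq_Icc
  rw [← setIntegral_congr_set hQ]
  have hmp := PiLp.volume_preserving_toLp (Fin (n + 1))
  have hpre : (univ.pi fun j => Ioo (a j) (b j)) = WithLp.toLp 2 ⁻¹' box a b := by
    ext x; simp [box]
  rw [hpre]
  exact (hmp.setIntegral_preimage_emb (MeasurableEquiv.toLp 2 _).measurableEmbedding _ _).symm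

/-- Smooth fields supported away from `∂_D Σ` have vanishing normal trace on `∂_D Σ`. -/
theorem normalTraceZeroOff_of_mem_CcInfty {n : ℕ} {a b : Fin (n + 1) → ℝ} (hab : ∀ i, a i < b i)
    {Ia Ib : Set (Fin (n + 1))} {w : Fin (n + 1) → E (n + 1) → ℝ}
    (hw : ∀ i, w i ∈ CcInfty (box a b) (bdryD a b Ia Ib) ℝ) :
    NormalTraceZeroOff (box a b) (bdryN a b Ia Ib) w := by
  rintro v ⟨-, φ, hφ, hjet, htr⟩
  have hdiv := (isWeakDiv_of_contDiff a b fun i => (hw i).1).weakDiv_ae_eq (isOpen_box a b)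
  set g : E (n + 1) → ℝ := fun x => ∑ i, fderiv ℝ (w i) x (basisVec i) with hg
  have hgc : Continuous g := continuous_finsetSum _ fun i _ => continuous_fderiv_basisVec (hw i).1 i
  set μ := (volume : Measure (E (n + 1))).restrict (box a b) with hμ
  have hwL : ∀ i, MemLp (w i) 2 μ := fun i => memLp_box_of_continuous a b (hw i).1.continuous 2
  have hgL : MemLp g 2 μ := memLp_box_of_continuous a b hgc 2
  have hpair : normalPairing (box a b) w v =
      (∑ i, ∫ x, w i x * v (some i) x ∂μ) + ∫ x, g x * v none x ∂μ := by
    rw [← integral_finsetSum _ fun i _ => integrable_mul_of_memLp (hwL i) (Lp.memLp (v (some i))),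
      ← integral_add (integrable_finsetSum _ fun i _ => 
        integrable_mul_of_memLp (hwL i) (Lp.memLp (v (some i))))
        (integrable_mul_of_memLp hgL (Lp.memLp (v none)))]
    refine integral_congr_ae ?_
    filter_upwards [hdiv] with x hx
    rw [hx]
  have hlim : ∀ {f : E (n + 1) → ℝ}, MemLp f 2 μ → ∀ j,
      Tendsto (fun k => ∫ x, f x * jet (φ k) j x ∂μ) atTop (𝓝 (∫ x, f x * v j x ∂μ)) := by
    intro f hf j
    have h0 := tendsto_integral_mul_zero hf (g := fun k => jet (φ k) j - (v j : E (n + 1) → ℝ))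
      (fun k => (continuous_jet (hφ k) j).aestronglyMeasurable.sub (Lp.aestronglyMeasurable _))
      (hjet j)
    have h1 := h0.add_const (∫ x, f x * v j x ∂μ)
    rw [zero_add] at h1
    refine h1.congr fun k => ?_
    simp only [Pi.sub_apply, mul_sub]
    rw [integral_sub (integrable_mul_of_memLp hf
      (memLp_box_of_continuous a b (continuous_jet (hφ k) j) 2))
      (integrable_mul_of_memLp hf (Lp.memLp (v j))), sub_add_cancel]
  have hlim1 := (tendsto_finsetSum Finset.univ fun i _ => hlim (hwL i) (some i)).add
    (hlim hgL none)
  rw [← hpair] at hlim1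
  have hlim2 := tendsto_finsetSum Finset.univ fun i _ =>
    (tendsto_face_integral hab (hw i) (fun k => (hφ k).continuous) htr i (Or.inr rfl)).sub
      (tendsto_face_integral hab (hw i) (fun k => (hφ k).continuous) htr i (Or.inl rfl))
  simp only [sub_zero, Finset.sum_const_zero] at hlim2
  -- For each `k` the volume integral equals the sum of the face integrals; the former tends to the
  -- pairing, the latter to zero.
  refine tendsto_nhds_unique (hlim1.congr fun k => ?_) hlim2
  rw [← integral_box_green hab (fun i => (hw i).1) (hφ k)]
  rw [← integral_finsetSum _ fun i _ => integrable_mul_of_memLp (hwL i)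
      (memLp_box_of_continuous a b (continuous_jet (hφ k) (some i)) 2),
    ← integral_add (integrable_finsetSum _ fun i _ => integrable_mul_of_memLp (hwL i)
      (memLp_box_of_continuous a b (continuous_jet (hφ k) (some i)) 2))
        (integrable_mul_of_memLp hgL (memLp_box_of_continuous a b (continuous_jet (hφ k) none) 2))]
  rfl

/-! ### Convolution in `L²` -/

theorem eLpNorm_two_sq {α G : Type*} [MeasurableSpace α] [NormedAddCommGroup G] (f : α → G)
    (μ : Measure α) : eLpNorm f 2 μ ^ (2 : ℝ) = ∫⁻ x, ‖f x‖ₑ ^ (2 : ℝ) ∂μ := by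
  rw [eLpNorm_eq_lintegral_rpow_enorm_toReal two_ne_zero ENNReal.ofNat_ne_top]
  simp only [ENNReal.toReal_ofNat]
  rw [← ENNReal.rpow_mul]
  norm_num

/-- Cauchy–Schwarz after splitting `k * g` as `√k * (√k * g)`; in effect, for the measure with
density `k`. -/
theorem lintegral_mul_sq_le {α : Type*} [MeasurableSpace α] {μ : Measure α} {k g : α → ℝ≥0∞}
    (hk : AEMeasurable k μ) (hg : AEMeasurable g μ) :
    (∫⁻ t, k t * g t ∂μ) ^ (2 : ℝ) ≤ (∫⁻ t, k t ∂μ) * ∫⁻ t, k t * g t ^ (2 : ℝ) ∂μ := by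
  have hhalf : ∀ c : ℝ≥0∞, (c ^ (1 / 2 : ℝ)) ^ (2 : ℝ) = c := fun c => by
    rw [← ENNReal.rpow_mul]; norm_num
  have hmul : ∀ c : ℝ≥0∞, c ^ (1 / 2 : ℝ) * c ^ (1 / 2 : ℝ) = c := fun c => by
    rw [← ENNReal.rpow_add_of_nonneg _ _ (by norm_num) (by norm_num)]; norm_num
  have h := ENNReal.lintegral_mul_le_Lp_mul_Lq μ Real.HolderConjugate.two_two
    (hk.pow_const (1 / 2 : ℝ)) ((hk.pow_const (1 / 2 : ℝ)).mul hg)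
  have e1 : ∫⁻ t, ((fun t => k t ^ (1 / 2 : ℝ)) * ((fun t => k t ^ (1 / 2 : ℝ)) * g)) t ∂μ =
      ∫⁻ t, k t * g t ∂μ := by
    refine lintegral_congr fun t => ?_
    simp only [Pi.mul_apply, ← mul_assoc, hmul]
  have e2 : ∫⁻ t, ((fun t => k t ^ (1 / 2 : ℝ)) * g) t ^ (2 : ℝ) ∂μ =
      ∫⁻ t, k t * g t ^ (2 : ℝ) ∂μ := by
    refine lintegral_congr fun t => ?_
    rw [Pi.mul_apply, ENNReal.mul_rpow_of_nonneg _ _ (by norm_num), hhalf]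
  rw [e1, e2] at h
  simp only [hhalf] at h
  refine (ENNReal.rpow_le_rpow h (by norm_num : (0 : ℝ) ≤ 2)).trans (le_of_eq ?_)
  rw [ENNReal.mul_rpow_of_nonneg _ _ (by norm_num), hhalf, hhalf]

/-- An averaged family of functions, each of `L²`-norm at most `M`, has `L²`-norm at most `M` times
the total mass of the weight. -/
theorem eLpNorm_integral_smul_le {α β G : Type*} [MeasurableSpace α] [MeasurableSpace β]
    [NormedAddCommGroup G] [NormedSpace ℝ G] {μ : Measure α} {ν : Measure β} [SFinite μ]
    [SFinite ν] {κ : β → ℝ} (hκ : Measurable κ) {h : α → β → G}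
    (hh : AEStronglyMeasurable (Function.uncurry h) (μ.prod ν)) {M : ℝ≥0∞}
    (hM : ∀ t, κ t ≠ 0 → eLpNorm (fun x => h x t) 2 μ ≤ M) :
    eLpNorm (fun x => ∫ t, κ t • h x t ∂ν) 2 μ ≤ (∫⁻ t, ‖κ t‖ₑ ∂ν) * M := by
  rw [← ENNReal.rpow_le_rpow_iff (by norm_num : (0 : ℝ) < 2), eLpNorm_two_sq]
  set K := ∫⁻ t, ‖κ t‖ₑ ∂ν with hK
  have hκm : AEMeasurable (fun t => ‖κ t‖ₑ) ν := hκ.enorm.aemeasurable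
  have hhm : AEMeasurable (fun z : α × β => ‖κ z.2‖ₑ * ‖h z.1 z.2‖ₑ ^ (2 : ℝ)) (μ.prod ν) :=
    (hκ.enorm.comp measurable_snd).aemeasurable.mul (hh.enorm.pow_const _)
  -- Weighted Cauchy–Schwarz in `t`, followed by Tonelli. Only the values of `t` with `κ t ≠ 0`
  -- contribute, which is why the bound `M` is required only there.
  calc ∫⁻ x, ‖∫ t, κ t • h x t ∂ν‖ₑ ^ (2 : ℝ) ∂μ
      ≤ ∫⁻ x, K * ∫⁻ t, ‖κ t‖ₑ * ‖h x t‖ₑ ^ (2 : ℝ) ∂ν ∂μ := by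
        refine lintegral_mono_ae ?_
        filter_upwards [hh.prodMk_left] with x hx
        refine le_trans
          (ENNReal.rpow_le_rpow (enorm_integral_le_lintegral_enorm _) (by norm_num)) ?_
        simp_rw [enorm_smul]
        exact lintegral_mul_sq_le hκm hx.enorm
    _ = K * ∫⁻ t, ∫⁻ x, ‖κ t‖ₑ * ‖h x t‖ₑ ^ (2 : ℝ) ∂μ ∂ν := by
        rw [lintegral_const_mul'' _ hhm.lintegral_prod_right', lintegral_lintegral_swap hhm]
    _ ≤ K * ∫⁻ t, ‖κ t‖ₑ * M ^ (2 : ℝ) ∂ν := by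
        gcongr with t
        by_cases ht : κ t = 0
        · simp [ht]
        · rw [lintegral_const_mul' _ _ enorm_ne_top, ← eLpNorm_two_sq]
          gcongr
          exact hM t ht
    _ = (K * M) ^ (2 : ℝ) := by
        rw [lintegral_mul_const'' _ hκm, ENNReal.mul_rpow_of_nonneg _ _ (by norm_num), ← mul_assoc,
          ← hK]
        norm_num [pow_two]

/-- Translations preserve the measure and depend continuously on the shift in the compact-open
topology, so composition with them is continuous in `L²`. -/
theorem exists_eLpNorm_translate_sub_le {d : ℕ} {G : Type*} [NormedAddCommGroup G]
    {f : E d → G} (hf : MemLp f 2 volume) {ε : ℝ≥0∞} (hε : 0 < ε) : ∃ r > 0, ∀ t : E d, ‖t‖ < r →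
      eLpNorm (fun x => f (x - t) - f x) 2 volume ≤ ε := by
  have hmp : ∀ t : E d, MeasurePreserving (fun x : E d => x - t) volume volume :=
    fun t => measurePreserving_sub_right volume t
  let T : E d → C(E d, E d) := fun t => ⟨fun x => x - t, by fun_prop⟩
  have hT : Continuous T := ContinuousMap.continuous_of_continuous_uncurry _ (by
    simp only [T]
    exact continuous_snd.sub continuous_fst)
  have hcont := (continuous_const (y := hf.toLp f)).compMeasurePreservingLp hT
    (fun t => hmp t) ENNReal.ofNat_ne_top
  have h0 := (EMetric.tendsto_nhds.1 (hcont.tendsto 0)) ε hε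
  obtain ⟨r, hr, hball⟩ := Metric.eventually_nhds_iff.1 h0
  refine ⟨r, hr, fun t ht => ?_⟩
  have h1 := hball (y := t) (by simpa using ht)
  rw [Lp.edist_def] at h1
  refine le_trans (le_of_eq (eLpNorm_congr_ae ?_)) h1.le
  have e : ∀ t : E d, Lp.compMeasurePreserving (T t) (hmp t) (hf.toLp f) =ᵐ[volume]
      fun x => f (x - t) := fun t =>
    (Lp.coeFn_compMeasurePreserving _ (hmp t)).trans
      ((hmp t).quasiMeasurePreserving.ae_eq_comp hf.coeFn_toLp)
  filter_upwards [e t, e 0] with x hx h0x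
  simp only [Pi.sub_apply, hx, h0x, sub_zero]

/-- Convolution of a scalar kernel with a vector valued function. -/
def conv {d : ℕ} {G : Type*} [NormedAddCommGroup G] [NormedSpace ℝ G] (κ : E d → ℝ)
    (f : E d → G) : E d → G :=
  convolution κ f (ContinuousLinearMap.lsmul ℝ ℝ) volume

section

variable {d : ℕ} {G : Type*} [NormedAddCommGroup G] [NormedSpace ℝ G]

theorem conv_apply (κ : E d → ℝ) (f : E d → G) (x : E d) :
    conv κ f x = ∫ t, κ t • f (x - t) := rfl

theorem conv_apply_swap (κ : E d → ℝ) (f : E d → G) (x : E d) :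
    conv κ f x = ∫ t, κ (x - t) • f t := convolution_lsmul_swap

theorem integrable_conv {κ : E d → ℝ} (hκ : Continuous κ) (hc : HasCompactSupport κ) {f : E d → G}
    (hf : LocallyIntegrable f) (x : E d) : Integrable fun t => κ t • f (x - t) :=
  hc.convolutionExists_left (ContinuousLinearMap.lsmul ℝ ℝ) hκ hf x

theorem conv_sub {κ : E d → ℝ} (hκ : Continuous κ) (hc : HasCompactSupport κ) {f g : E d → G}
    (hf : LocallyIntegrable f) (hg : LocallyIntegrable g) (x : E d) :
    conv κ (f - g) x = conv κ f x - conv κ g x := by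
  simp only [conv_apply, Pi.sub_apply, smul_sub]
  exact integral_sub (integrable_conv hκ hc hf x) (integrable_conv hκ hc hg x)

theorem eLpNorm_conv_le {κ : E d → ℝ} (hκ : Continuous κ) {f : E d → G}
    (hf : AEStronglyMeasurable f volume) :
    eLpNorm (conv κ f) 2 volume ≤ (∫⁻ t, ‖κ t‖ₑ) * eLpNorm f 2 volume := by
  refine eLpNorm_integral_smul_le hκ.measurable (h := fun x t => f (x - t)) ?_ fun t _ => ?_
  · exact hf.comp_quasiMeasurePreserving
      (quasiMeasurePreserving_sub_of_right_invariant volume volume)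
  · exact (eLpNorm_comp_measurePreserving hf (measurePreserving_sub_right volume t)).le

/-- Convolution with a probability density concentrated near zero is close to the identity. -/
theorem exists_eLpNorm_conv_sub_le [CompleteSpace G] {f : E d → G} (hf : MemLp f 2 volume)
    {ε : ℝ≥0∞} (hε : 0 < ε) :
    ∃ r > 0, ∀ κ : E d → ℝ, Continuous κ → HasCompactSupport κ → (∀ t, 0 ≤ κ t) → ∫ t, κ t = 1 →
      (∀ t, κ t ≠ 0 → ‖t‖ < r) → eLpNorm (conv κ f - f) 2 volume ≤ ε := by
  obtain ⟨r, hr, h⟩ := exists_eLpNorm_translate_sub_le hf hε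
  refine ⟨r, hr, fun κ hκ hc hpos hone hsupp => ?_⟩
  have hint : Integrable κ := hκ.integrable_of_hasCompactSupport hc
  have hloc := hf.locallyIntegrable (by norm_num)
  have hmass : ∫⁻ t, ‖κ t‖ₑ = 1 := by
    rw [← ENNReal.ofReal_one, ← hone, ofReal_integral_eq_lintegral_ofReal hint
      (Eventually.of_forall hpos)]
    exact lintegral_congr fun t => Real.enorm_of_nonneg (hpos t)
  -- Since `κ` has mass one, the error at `x` is the `κ`-average of `f (x - t) - f x`, and each of
  -- these translation errors has norm at most `ε`.
  have key := eLpNorm_integral_smul_le (μ := volume) (ν := volume) hκ.measurable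
    (h := fun x t => f (x - t) - f x) ?_ fun t ht => h t (hsupp t ht)
  · rw [hmass, one_mul] at key
    refine le_trans (le_of_eq (congrArg (fun F => eLpNorm F 2 volume) (funext fun x => ?_))) key
    simp only [smul_sub, Pi.sub_apply]
    rw [integral_sub (integrable_conv hκ hc hloc x) (hint.smul_const _), integral_smul_const, hone,
      one_smul, conv_apply]
  · exact (hf.1.comp_quasiMeasurePreserving
      (quasiMeasurePreserving_sub_of_right_invariant volume volume)).sub
      (hf.1.comp_quasiMeasurePreserving Measure.quasiMeasurePreserving_fst)

theorem contDiff_conv {κ : E d → ℝ} (hκ : ContDiff ℝ ∞ κ) (hc : HasCompactSupport κ) {f : E d → G}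
    (hf : LocallyIntegrable f) : ContDiff ℝ ∞ (conv κ f) :=
  hc.contDiff_convolution_left _ hκ hf

/-- The derivative falls on the kernel, so `f` needs only local integrability; for an extension by
zero this is all that is available. -/
theorem fderiv_conv [CompleteSpace G] {κ : E d → ℝ} (hκ : ContDiff ℝ ∞ κ) (hc : HasCompactSupport κ)
    {f : E d → G} (hf : LocallyIntegrable f) (x v : E d) :
    fderiv ℝ (conv κ f) x v = conv (fun t => fderiv ℝ κ t v) f x := by
  have h := hc.hasFDerivAt_convolution_left (ContinuousLinearMap.lsmul ℝ ℝ)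
    (hκ.of_le (by simp)) hf x
  rw [conv, h.fderiv, conv_apply, convolution_def, ContinuousLinearMap.integral_apply]
  · rfl
  · exact (hc.fderiv ℝ).convolutionExists_left _ (hκ.continuous_fderiv (by simp)) hf x

end

/-! ### Partition of unity and kernels adapted to the faces of the box -/

/-- A smooth function of `x_i` that vanishes on the lower third of `(a_i, b_i)` and is one on the
upper third. -/
def ramp {d : ℕ} (a b : Fin d → ℝ) (i : Fin d) (x : E d) : ℝ :=
  Real.smoothTransition (3 * (x i - a i) / (b i - a i) - 1)

/-- The partition of unity of the box, indexed by the vertices: `s` is the set of indices `i` for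
which the vertex lies in the upper face `x_i = b_i`. -/
def cut {d : ℕ} (a b : Fin d → ℝ) (s : Finset (Fin d)) (x : E d) : ℝ :=
  (∏ i ∈ s, ramp a b i x) * ∏ i ∈ Finset.univ \ s, (1 - ramp a b i x)

section

variable {d : ℕ} {a b : Fin d → ℝ}

theorem contDiff_ramp (i : Fin d) : ContDiff ℝ ∞ (ramp a b i) := by
  refine Real.smoothTransition.contDiff.comp ?_
  have h : ContDiff ℝ ∞ fun x : E d => x i := (EuclideanSpace.proj (𝕜 := ℝ) i).contDiff
  fun_prop

theorem contDiff_cut (s : Finset (Fin d)) : ContDiff ℝ ∞ (cut a b s) := by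
  refine ContDiff.mul (contDiff_prod fun i _ => contDiff_ramp i) (contDiff_prod fun i _ => ?_)
  exact contDiff_const.sub (contDiff_ramp i)

/-- Expand the product over `i` of `ramp i + (1 - ramp i) = 1`. -/
theorem sum_cut (x : E d) : ∑ s, cut a b s x = 1 := by
  have h := Finset.prod_add (fun i => ramp a b i x) (fun i => 1 - ramp a b i x) Finset.univ
  simp only [add_sub_cancel, Finset.prod_const_one, Finset.powerset_univ] at h
  exact h.symm

theorem cut_nonneg (s : Finset (Fin d)) (x : E d) : 0 ≤ cut a b s x :=
  mul_nonneg (Finset.prod_nonneg fun _ _ => Real.smoothTransition.nonneg _)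
    (Finset.prod_nonneg fun _ _ => sub_nonneg.2 (Real.smoothTransition.le_one _))

theorem abs_cut_le_one (s : Finset (Fin d)) (x : E d) : |cut a b s x| ≤ 1 := by
  rw [abs_of_nonneg (cut_nonneg s x), ← sum_cut (a := a) (b := b) x]
  exact Finset.single_le_sum (fun t _ => cut_nonneg t x) (Finset.mem_univ s)

theorem lower_lt_of_cut_ne_zero (hab : ∀ i, a i < b i) {s : Finset (Fin d)} {x : E d}
    (h : cut a b s x ≠ 0) {i : Fin d} (hi : i ∈ s) : a i + (b i - a i) / 3 < x i := by
  have h1 : ramp a b i x ≠ 0 := Finset.prod_ne_zero_iff.1 (left_ne_zero_of_mul h) i hi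
  by_contra! hle
  refine h1 (Real.smoothTransition.zero_of_nonpos ?_)
  rw [sub_nonpos, div_le_one (sub_pos.2 (hab i))]
  linarith

theorem lt_upper_of_cut_ne_zero (hab : ∀ i, a i < b i) {s : Finset (Fin d)} {x : E d}
    (h : cut a b s x ≠ 0) {i : Fin d} (hi : i ∉ s) : x i < b i - (b i - a i) / 3 := by
  have h1 : 1 - ramp a b i x ≠ 0 :=
    Finset.prod_ne_zero_iff.1 (right_ne_zero_of_mul h) i (by simp [hi])
  by_contra! hle
  refine h1 (sub_eq_zero.2 (Real.smoothTransition.one_of_one_le ?_).symm)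
  rw [le_sub_iff_add_le, le_div_iff₀ (sub_pos.2 (hab i))]
  linarith

end

/-- Mollification kernels `κ_s` of size `r`, to be combined with the partition of unity `cut a b s`:
in the patch `s` they only use values from points that are displaced outwards across the faces in
`∂_D Σ` and inwards from the faces in `∂_N Σ`. -/
structure IsAdapted {d : ℕ} (a b : Fin d → ℝ) (Ia Ib : Set (Fin d)) (r : ℝ)
    (κ : Finset (Fin d) → E d → ℝ) : Prop where
  smooth : ∀ s, ContDiff ℝ ∞ (κ s)
  compact : ∀ s, HasCompactSupport (κ s)
  nonneg : ∀ s t, 0 ≤ κ s t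
  integral : ∀ s, ∫ t, κ s t = 1
  supp : ∀ s t, κ s t ≠ 0 → ‖t‖ < r
  zero_of_bdryN : ∀ s, ∀ x ∈ box a b, cut a b s x ≠ 0 → ∀ z ∈ bdryN a b Ia Ib, κ s (x - z) = 0
  away : ∃ δ > 0, ∀ s x, ∀ z ∈ box a b, cut a b s x ≠ 0 → κ s (x - z) ≠ 0 →
    (∀ i ∈ Ia, a i + δ ≤ x i) ∧ ∀ i ∈ Ib, x i ≤ b i - δ

/-- The kernel for the patch `s` is a normalised bump around `δ • p s`. Every coordinate of its
points then has a prescribed sign and modulus larger than `δ`, so `z = x - t` is displaced in a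
prescribed direction in each coordinate. -/
theorem exists_isAdapted {d : ℕ} {a b : Fin d → ℝ} (hab : ∀ i, a i < b i) (Ia Ib : Set (Fin d))
    {r : ℝ} (hr : 0 < r) (hrab : ∀ i, r ≤ (b i - a i) / 3) :
    ∃ κ, IsAdapted a b Ia Ib r κ := by
  classical
  -- `up s i` means that `z` must lie above `x` in the coordinate `i`: outwards across an upper face
  -- in `∂_D Σ`, or inwards from a lower face not in it.
  let up : Finset (Fin d) → Fin d → Prop := fun s i => (i ∈ s ∧ i ∈ Ib) ∨ (i ∉ s ∧ i ∉ Ia)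
  let p : Finset (Fin d) → E d := fun s => WithLp.toLp 2 fun i => if up s i then -2 else 2
  let M : ℝ := ∑ s, ‖p s‖
  have hpM : ∀ s, ‖p s‖ ≤ M := fun s =>
    Finset.single_le_sum (f := fun s => ‖p s‖) (fun t _ => norm_nonneg _) (Finset.mem_univ s)
  have hM : 0 ≤ M := Finset.sum_nonneg fun t _ => norm_nonneg _
  -- A centre of norm at most `δ * M` and a radius `δ` keep the support inside the ball of radius `δ
  -- * (M + 2) = r`. The entries `±2` of `p s` leave a gap of width `δ` around zero in each
  -- coordinate.
  let δ : ℝ := r / (M + 2)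
  have hδ : 0 < δ := by positivity
  have hδr : δ * (M + 2) = r := div_mul_cancel₀ _ (by positivity)
  let B : ∀ s, ContDiffBump (δ • p s) := fun s =>
    { rIn := δ / 2, rOut := δ, rIn_pos := by positivity, rIn_lt_rOut := by linarith }
  have hsupp : ∀ s t, (B s).normed volume t ≠ 0 → ‖t - δ • p s‖ < δ := by
    intro s t ht
    have h : t ∈ Function.support ((B s).normed volume) := ht
    rw [(B s).support_normed_eq] at h
    simpa [B, dist_eq_norm] using h
  have hnorm : ∀ s t, (B s).normed volume t ≠ 0 → ‖t‖ < r := by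
    intro s t ht
    have h2 : ‖δ • p s‖ ≤ δ * M := by
      rw [norm_smul, Real.norm_of_nonneg hδ.le]
      exact mul_le_mul_of_nonneg_left (hpM s) hδ.le
    have h3 : ‖t‖ ≤ ‖t - δ • p s‖ + ‖δ • p s‖ := by
      simpa using norm_add_le (t - δ • p s) (δ • p s)
    nlinarith [hsupp s t ht]
  have hcoord : ∀ s t, (B s).normed volume t ≠ 0 → ∀ i, |t i - δ * p s i| < δ := by
    intro s t ht i
    have := PiLp.norm_apply_le (t - δ • p s) i
    simp only [PiLp.sub_apply, PiLp.smul_apply, smul_eq_mul, Real.norm_eq_abs] at this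
    exact this.trans_lt (hsupp s t ht)
  have hup : ∀ s t, (B s).normed volume t ≠ 0 → ∀ i, up s i → t i < -δ := by
    intro s t ht i hi
    have := hcoord s t ht i
    simp only [p, hi, if_true] at this
    linarith [(abs_lt.1 this).2]
  have hdown : ∀ s t, (B s).normed volume t ≠ 0 → ∀ i, ¬ up s i → δ < t i := by
    intro s t ht i hi
    have := hcoord s t ht i
    simp only [p, hi, if_false] at this
    linarith [(abs_lt.1 this).1]
  have habs : ∀ s t, (B s).normed volume t ≠ 0 → ∀ i, |t i| < r := fun s t ht i =>
    (PiLp.norm_apply_le t i).trans_lt (hnorm s t ht)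
  have hle : δ ≤ r := by nlinarith
  refine ⟨fun s => (B s).normed volume, fun s => (B s).contDiff_normed,
    fun s => (B s).hasCompactSupport_normed, fun s t => (B s).nonneg_normed t,
    fun s => (B s).integral_normed, hnorm, ?_, δ, hδ, ?_⟩
  · intro s x hx hcut z hz
    by_contra hne
    rcases exists_of_mem_bdryN hab hz with ⟨i, hi, hzi⟩ | ⟨i, hi, hzi⟩
    -- For `i ∈ s` the point `x` is more than a third of the edge away from this face, out of reach
    -- of a kernel of size `r`. Otherwise `z` would lie strictly above `x` and so could not be on
    -- the lower face.
    · by_cases his : i ∈ s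
      · have h1 := lower_lt_of_cut_ne_zero hab hcut his
        have h2 := (abs_lt.1 (habs s _ hne i)).2
        have h3 := hrab i
        simp only [PiLp.sub_apply] at h2
        linarith
      · have h1 := hup s _ hne i (Or.inr ⟨his, hi⟩)
        have h2 := (hx i).1
        simp only [PiLp.sub_apply] at h1
        linarith
    · by_cases his : i ∈ s
      · have h1 := hdown s _ hne i (by simp only [up]; tauto)
        have h2 := (hx i).2
        simp only [PiLp.sub_apply] at h1
        linarith
      · have h1 := lt_upper_of_cut_ne_zero hab hcut his
        have h2 := (abs_lt.1 (habs s _ hne i)).1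
        have h3 := hrab i
        simp only [PiLp.sub_apply] at h2
        linarith
  · intro s x z hz hcut hne
    -- Either the patch itself stays away from the face, or `z` is beyond `x` by more than `δ` in
    -- the outward direction and still inside the box.
    refine ⟨fun i hi => ?_, fun i hi => ?_⟩
    · by_cases his : i ∈ s
      · have h1 := lower_lt_of_cut_ne_zero hab hcut his
        have h3 := hrab i
        linarith
      · have h1 := hdown s _ hne i (by simp only [up]; tauto)
        have h2 := (hz i).1
        simp only [PiLp.sub_apply] at h1
        linarith
    · by_cases his : i ∈ s
      · have h1 := hup s _ hne i (Or.inl ⟨his, hi⟩)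
        have h2 := (hz i).2
        simp only [PiLp.sub_apply] at h1
        linarith
      · have h1 := lt_upper_of_cut_ne_zero hab hcut his
        have h3 := hrab i
        linarith

/-! ### The smoothing operator -/

/-- The local mollifications of `f`, extended by zero, glued with the partition of unity. -/
def glue {d : ℕ} (a b : Fin d → ℝ) {G : Type*} [NormedAddCommGroup G] [NormedSpace ℝ G]
    (κ : Finset (Fin d) → E d → ℝ) (f : E d → G) (x : E d) : G :=
  ∑ s, cut a b s x • conv (κ s) ((box a b).indicator f) x

/-- The divergence of the field with components `glue a b κ (w i)`. -/
def divGlue {d : ℕ} (a b : Fin d → ℝ) (κ : Finset (Fin d) → E d → ℝ) (w : Fin d → E d → ℝ)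
    (x : E d) : ℝ :=
  ∑ i, fderiv ℝ (glue a b κ (w i)) x (basisVec i)

section

variable {d : ℕ} {a b : Fin d → ℝ} {G : Type*} [NormedAddCommGroup G]

theorem memLp_indicator_box {f : E d → G} (hf : MemLp f 2 (volume.restrict (box a b))) :
    MemLp ((box a b).indicator f) 2 volume :=
  (memLp_indicator_iff_restrict (isOpen_box a b).measurableSet).2 hf

theorem locallyIntegrable_indicator_box {f : E d → G}
    (hf : MemLp f 2 (volume.restrict (box a b))) : LocallyIntegrable ((box a b).indicator f) :=
  (memLp_indicator_box hf).locallyIntegrable (by norm_num)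

variable [NormedSpace ℝ G]

theorem contDiff_glue {Ia Ib : Set (Fin d)} {r : ℝ} {κ : Finset (Fin d) → E d → ℝ}
    (hκ : IsAdapted a b Ia Ib r κ) {f : E d → G} (hf : MemLp f 2 (volume.restrict (box a b))) :
    ContDiff ℝ ∞ (glue a b κ f) :=
  ContDiff.sum fun s _ => (contDiff_cut s).smul
    (contDiff_conv (hκ.smooth s) (hκ.compact s) (locallyIntegrable_indicator_box hf))

/-- A nonzero value at `x` needs a patch containing `x` and a point `z` of the box seen by its
kernel. By adaptedness `x` then lies in a closed set at distance `δ` from all faces of `∂_D Σ`;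
closedness carries this over to the support. -/
theorem glue_mem_CcInfty {Ia Ib : Set (Fin d)} {r : ℝ}
    {κ : Finset (Fin d) → E d → ℝ} (hκ : IsAdapted a b Ia Ib r κ) {f : E d → G}
    (hf : MemLp f 2 (volume.restrict (box a b))) :
    glue a b κ f ∈ CcInfty (box a b) (closure (bdryD a b Ia Ib)) G := by
  refine ⟨contDiff_glue hκ hf, ?_⟩
  obtain ⟨δ, hδ, haway⟩ := hκ.away
  let C : Set (E d) := {x | (∀ i ∈ Ia, a i + δ ≤ x i) ∧ ∀ i ∈ Ib, x i ≤ b i - δ}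
  have hC : IsClosed C := by
    have h : C = (⋂ i ∈ Ia, {x : E d | a i + δ ≤ x i}) ∩ ⋂ i ∈ Ib, {x : E d | x i ≤ b i - δ} := by
      ext x; simp [C]
    rw [h]
    exact (isClosed_biInter fun i _ => isClosed_le continuous_const (by fun_prop)).inter
      (isClosed_biInter fun i _ => isClosed_le (by fun_prop) continuous_const)
  have hsub : closure (closure (box a b) ∩ Function.support (glue a b κ f)) ⊆
      closure (box a b) ∩ C := by
    refine closure_minimal (fun x hx => ⟨hx.1, ?_⟩) (isClosed_closure.inter hC)
    obtain ⟨s, -, hs⟩ := Finset.exists_ne_zero_of_sum_ne_zero hx.2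
    have hcut : cut a b s x ≠ 0 := fun h => hs (by rw [h, zero_smul])
    have hconv : conv (κ s) ((box a b).indicator f) x ≠ 0 := fun h => hs (by rw [h, smul_zero])
    obtain ⟨z, hz⟩ : ∃ z, κ s (x - z) • (box a b).indicator f z ≠ 0 := by
      by_contra! h
      refine hconv ?_
      rw [conv_apply_swap]
      simp [h]
    have hzb : z ∈ box a b := by
      by_contra h
      exact hz (by rw [indicator_of_notMem h, smul_zero])
    exact haway s x z hzb hcut fun h => hz (by rw [h, zero_smul])
  intro x hx
  obtain ⟨h1, h2, h3⟩ := hsub hx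
  refine ⟨h1, fun hD => ?_⟩
  rcases closure_bdryD_subset a b Ia Ib hD with ⟨i, hi, h⟩ | ⟨i, hi, h⟩
  · linarith [h2 i hi]
  · linarith [h3 i hi]

theorem glue_sub {Ia Ib : Set (Fin d)} {r : ℝ} {κ : Finset (Fin d) → E d → ℝ}
    (hκ : IsAdapted a b Ia Ib r κ) {f g : E d → G} (hf : MemLp f 2 (volume.restrict (box a b)))
    (hg : MemLp g 2 (volume.restrict (box a b))) :
    glue a b κ (f - g) = glue a b κ f - glue a b κ g := by
  ext x
  simp only [glue, Pi.sub_apply, ← Finset.sum_sub_distrib, ← smul_sub]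
  refine Finset.sum_congr rfl fun s _ => ?_
  rw [← conv_sub (hκ.smooth s).continuous (hκ.compact s) (locallyIntegrable_indicator_box hf)
    (locallyIntegrable_indicator_box hg), ← indicator_sub']

end

/-! ### `L²` estimates for the smoothing operator and its divergence -/

section

variable {d : ℕ} {a b : Fin d → ℝ}

theorem eLpNorm_sum_smul_le {J G : Type*} [Fintype J] [NormedAddCommGroup G] [NormedSpace ℝ G]
    {χ : J → E d → ℝ} (hχ : ∀ s, Continuous (χ s)) {C : ℝ≥0}
    (hC : ∀ s, ∀ x ∈ box a b, |χ s x| ≤ C) {F : J → E d → G}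
    (hF : ∀ s, AEStronglyMeasurable (F s) volume) :
    eLpNorm (fun x => ∑ s, χ s x • F s x) 2 (volume.restrict (box a b)) ≤
      ∑ s, (C : ℝ≥0∞) * eLpNorm (F s) 2 volume := by
  have hsum := eLpNorm_sum_le (μ := volume.restrict (box a b)) (p := 2) (s := Finset.univ)
    (f := fun s x => χ s x • F s x)
    (fun s _ => (hχ s).aestronglyMeasurable.smul (hF s).restrict) (by norm_num)
  have e : (∑ s, fun x => χ s x • F s x) = fun x => ∑ s, χ s x • F s x := by
    ext x; simp
  rw [e] at hsum
  refine hsum.trans (Finset.sum_le_sum fun s _ => ?_)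
  refine (eLpNorm_le_nnreal_smul_eLpNorm_of_ae_le_mul (g := F s) (c := C) ?_ 2).trans ?_
  · filter_upwards [ae_restrict_mem (isOpen_box a b).measurableSet] with x hx
    rw [← NNReal.coe_le_coe, NNReal.coe_mul, coe_nnnorm, coe_nnnorm, norm_smul, Real.norm_eq_abs]
    exact mul_le_mul_of_nonneg_right (hC s x hx) (norm_nonneg _)
  · rw [ENNReal.smul_def, smul_eq_mul]
    gcongr
    exact Measure.restrict_le_self

theorem lintegral_enorm_lt_top {κ : E d → ℝ} (hκ : Continuous κ) (hc : HasCompactSupport κ) :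
    ∫⁻ t, ‖κ t‖ₑ < ⊤ := (hκ.integrable_of_hasCompactSupport hc).2

theorem aestronglyMeasurable_conv {G : Type*} [NormedAddCommGroup G] [NormedSpace ℝ G] {κ : E d → ℝ}
    (hκ : ContDiff ℝ ∞ κ) (hc : HasCompactSupport κ) {f : E d → G} (hf : LocallyIntegrable f) :
    AEStronglyMeasurable (conv κ f) volume :=
  (contDiff_conv hκ hc hf).continuous.aestronglyMeasurable

theorem conv_indicator {G : Type*} [NormedAddCommGroup G] [NormedSpace ℝ G] (κ : E d → ℝ)
    (f : E d → G) (x : E d) :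
    conv κ ((box a b).indicator f) x = ∫ t in box a b, κ (x - t) • f t := by
  rw [conv_apply_swap, ← integral_indicator (isOpen_box a b).measurableSet]
  congr 1
  ext t
  rw [indicator_smul_apply]

theorem contDiff_fderiv_basisVec {κ : E d → ℝ} (hκ : ContDiff ℝ ∞ κ) (i : Fin d) :
    ContDiff ℝ ∞ fun t => fderiv ℝ κ t (basisVec i) :=
  (hκ.fderiv_right (m := ∞) (by simp)).clm_apply contDiff_const

section

variable {Ia Ib : Set (Fin d)} {r : ℝ} {κ : Finset (Fin d) → E d → ℝ}

/-- The smoothing operator is bounded in `L²`. -/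
theorem eLpNorm_glue_le {G : Type*} [NormedAddCommGroup G] [NormedSpace ℝ G]
    (hκ : IsAdapted a b Ia Ib r κ) {f : E d → G} (hf : MemLp f 2 (volume.restrict (box a b))) :
    eLpNorm (glue a b κ f) 2 (volume.restrict (box a b)) ≤
      (∑ s, ∫⁻ t, ‖κ s t‖ₑ) * eLpNorm f 2 (volume.restrict (box a b)) := by
  refine (eLpNorm_sum_smul_le (fun s => (contDiff_cut s).continuous) (C := 1)
    (fun s x _ => abs_cut_le_one s x) fun s => aestronglyMeasurable_conv (hκ.smooth s)
      (hκ.compact s) (locallyIntegrable_indicator_box hf)).trans ?_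
  rw [Finset.sum_mul]
  refine Finset.sum_le_sum fun s _ => ?_
  rw [ENNReal.coe_one, one_mul]
  refine (eLpNorm_conv_le (hκ.smooth s).continuous (memLp_indicator_box hf).1).trans ?_
  rw [eLpNorm_indicator_eq_eLpNorm_restrict (isOpen_box a b).measurableSet]

/-- The error of the smoothing operator is controlled by the errors of the mollifications. -/
theorem eLpNorm_glue_sub_le {G : Type*} [NormedAddCommGroup G] [NormedSpace ℝ G]
    (hκ : IsAdapted a b Ia Ib r κ) {f : E d → G} (hf : MemLp f 2 (volume.restrict (box a b))) :
    eLpNorm (glue a b κ f - f) 2 (volume.restrict (box a b)) ≤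
      ∑ s, eLpNorm (conv (κ s) ((box a b).indicator f) - (box a b).indicator f) 2 volume := by
  have h := eLpNorm_sum_smul_le (a := a) (b := b)
    (fun s => (contDiff_cut (a := a) (b := b) s).continuous)
    (C := 1) (fun s x _ => abs_cut_le_one s x)
    (F := fun s => conv (κ s) ((box a b).indicator f) - (box a b).indicator f)
    fun s => (aestronglyMeasurable_conv (hκ.smooth s)
      (hκ.compact s) (locallyIntegrable_indicator_box hf)).sub (memLp_indicator_box hf).1
  simp only [ENNReal.coe_one, one_mul] at h
  refine le_trans (le_of_eq (eLpNorm_congr_ae ?_)) h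
  filter_upwards [ae_restrict_mem (isOpen_box a b).measurableSet] with x hx
  simp only [Pi.sub_apply, smul_sub, Finset.sum_sub_distrib, ← Finset.sum_smul, sum_cut, one_smul,
    indicator_of_mem hx, glue]

/-- The product rule: the first sum has all derivatives on the kernels, the second is the commutator
with the partition of unity. -/
theorem divGlue_eq (hκ : IsAdapted a b Ia Ib r κ) {w : Fin d → E d → ℝ}
    (hw : ∀ i, MemLp (w i) 2 (volume.restrict (box a b))) (x : E d) :
    divGlue a b κ w x =
      ∑ s, cut a b s x *
        ∑ i, conv (fun t => fderiv ℝ (κ s) t (basisVec i)) ((box a b).indicator (w i)) x +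
      ∑ q : Finset (Fin d) × Fin d, fderiv ℝ (cut a b q.1) x (basisVec q.2) *
        conv (κ q.1) ((box a b).indicator (w q.2)) x := by
  have h : ∀ i, fderiv ℝ (glue a b κ (w i)) x (basisVec i) =
      ∑ s, (cut a b s x *
          conv (fun t => fderiv ℝ (κ s) t (basisVec i)) ((box a b).indicator (w i)) x +
        fderiv ℝ (cut a b s) x (basisVec i) * conv (κ s) ((box a b).indicator (w i)) x) := by
    intro i
    have hloc := locallyIntegrable_indicator_box (hw i)
    have hd : HasFDerivAt (glue a b κ (w i)) (∑ s, (cut a b s x •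
        fderiv ℝ (conv (κ s) ((box a b).indicator (w i))) x +
          conv (κ s) ((box a b).indicator (w i)) x • fderiv ℝ (cut a b s) x)) x := by
      refine HasFDerivAt.fun_sum fun s _ => ?_
      exact ((contDiff_cut s).differentiable (by simp) x).hasFDerivAt.mul
        (((contDiff_conv (hκ.smooth s) (hκ.compact s) hloc).differentiable (by simp)
          x).hasFDerivAt)
    rw [hd.fderiv, _root_.sum_apply]
    refine Finset.sum_congr rfl fun s _ => ?_
    rw [_root_.add_apply, _root_.smul_apply, _root_.smul_apply,
      fderiv_conv (hκ.smooth s) (hκ.compact s) hloc, smul_eq_mul, smul_eq_mul,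
      mul_comm (conv _ _ x) (fderiv ℝ (cut a b s) x _)]
  simp only [divGlue, h]
  rw [Finset.sum_comm, Fintype.sum_prod_type]
  simp only [Finset.sum_add_distrib, Finset.mul_sum]

/-- Differentiate `sum_cut`. This makes the commutator terms cancel once the mollifications are
replaced by the field itself. -/
theorem sum_fderiv_cut (x : E d) (i : Fin d) :
    ∑ s, fderiv ℝ (cut a b s) x (basisVec i) = 0 := by
  have h1 : HasFDerivAt (fun x => ∑ s, cut a b s x) (∑ s, fderiv ℝ (cut a b s) x) x :=
    HasFDerivAt.fun_sum fun s _ => ((contDiff_cut s).differentiable (by simp) x).hasFDerivAt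
  simp only [sum_cut] at h1
  have h2 := h1.unique (hasFDerivAt_const (1 : ℝ) x)
  have h3 := congrArg (fun L : E d →L[ℝ] ℝ => L (basisVec i)) h2
  simpa [_root_.sum_apply] using h3

/-- Where `cut a b s` does not vanish, the mollification with `κ s` commutes with the divergence of
fields with vanishing normal trace on `∂_D Σ`. -/
theorem sum_conv_fderiv_eq (hκ : IsAdapted a b Ia Ib r κ) {w : Fin d → E d → ℝ}
    (hw : ∀ i, MemLp (w i) 2 (volume.restrict (box a b))) (hdiv : HasL2Div (box a b) w)
    (htr : NormalTraceZeroOff (box a b) (bdryN a b Ia Ib) w) {s : Finset (Fin d)} {x : E d}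
    (hx : x ∈ box a b) (hcut : cut a b s x ≠ 0) :
    ∑ i, conv (fun t => fderiv ℝ (κ s) t (basisVec i)) ((box a b).indicator (w i)) x =
      conv (κ s) ((box a b).indicator (weakDiv (box a b) w)) x := by
  -- This is the test function for the normal trace condition: by adaptedness it vanishes on `∂_N
  -- Σ`, although it need not vanish on `∂_D Σ`.
  have hφ : ContDiff ℝ ∞ fun z => κ s (x - z) := (hκ.smooth s).comp (contDiff_const.sub contDiff_id)
  have hfd : ∀ z i, fderiv ℝ (fun z => κ s (x - z)) z (basisVec i) =
      -fderiv ℝ (κ s) (x - z) (basisVec i) := by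
    intro z i
    have h1 := (((hκ.smooth s).differentiable (by simp) (x - z)).hasFDerivAt).comp z
      ((hasFDerivAt_id z).const_sub x)
    have h2 : fderiv ℝ (fun z => κ s (x - z)) z = _ := h1.fderiv
    rw [h2]
    simp
  have key := htr.integral_smooth hφ (hκ.zero_of_bdryN s x hx hcut)
  simp only [hfd, mul_neg, Finset.sum_neg_distrib] at key
  have hi : ∀ {f k : E d → ℝ}, MemLp f 2 (volume.restrict (box a b)) → Continuous k →
      Integrable (fun t => k (x - t) * f t) (volume.restrict (box a b)) := fun hf hk =>
    integrable_mul_of_memLp (memLp_box_of_continuous a b (by fun_prop) 2) hf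
  have h1 : ∀ i, Integrable (fun z => fderiv ℝ (κ s) (x - z) (basisVec i) * w i z)
      (volume.restrict (box a b)) := fun i =>
    hi (k := fun t => fderiv ℝ (κ s) t (basisVec i)) (hw i)
      (continuous_fderiv_basisVec (hκ.smooth s) i)
  have h2 : Integrable (fun z => κ s (x - z) * weakDiv (box a b) w z)
      (volume.restrict (box a b)) :=
    hi (isWeakDiv_weakDiv hdiv).1 (hκ.smooth s).continuous
  simp only [conv_indicator, smul_eq_mul]
  rw [← integral_finsetSum _ fun i _ => h1 i, ← sub_eq_zero,
    ← integral_sub (integrable_finsetSum _ fun i _ => h1 i) h2, ← neg_eq_zero, ← integral_neg]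
  rw [← key]
  congr 1
  ext z
  simp only [mul_comm (w _ z), mul_comm (weakDiv (box a b) w z)]
  ring

theorem exists_fderiv_cut_bound (a b : Fin d → ℝ) : ∃ C : ℝ≥0, ∀ q : Finset (Fin d) × Fin d,
    ∀ x ∈ box a b, |fderiv ℝ (cut a b q.1) x (basisVec q.2)| ≤ C := by
  have h : ∀ q : Finset (Fin d) × Fin d, ∃ C : ℝ, ∀ x ∈ closure (box a b),
      ‖fderiv ℝ (cut a b q.1) x (basisVec q.2)‖ ≤ C := fun q =>
    (isCompact_closure_box a b).exists_bound_of_continuousOn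
      (continuous_fderiv_basisVec (contDiff_cut q.1) q.2).continuousOn
  choose C hC using h
  refine ⟨∑ q, (C q).toNNReal, fun q x hx => (hC q x (subset_closure hx)).trans ?_⟩
  refine (Real.le_coe_toNNReal (C q)).trans (NNReal.coe_le_coe.2 ?_)
  exact Finset.single_le_sum (f := fun q => (C q).toNNReal) (fun _ _ => zero_le) (Finset.mem_univ q)

/-- The divergence of the smoothed field is close to the divergence of the field. -/
theorem eLpNorm_divGlue_sub_le (hκ : IsAdapted a b Ia Ib r κ) {w : Fin d → E d → ℝ}
    (hw : ∀ i, MemLp (w i) 2 (volume.restrict (box a b))) (hdiv : HasL2Div (box a b) w)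
    (htr : NormalTraceZeroOff (box a b) (bdryN a b Ia Ib) w) {C : ℝ≥0}
    (hC : ∀ q : Finset (Fin d) × Fin d, ∀ x ∈ box a b,
      |fderiv ℝ (cut a b q.1) x (basisVec q.2)| ≤ C) :
    eLpNorm (divGlue a b κ w - weakDiv (box a b) w) 2 (volume.restrict (box a b)) ≤
      ∑ s, eLpNorm (conv (κ s) ((box a b).indicator (weakDiv (box a b) w)) -
        (box a b).indicator (weakDiv (box a b) w)) 2 volume +
      ∑ q : Finset (Fin d) × Fin d, C * eLpNorm (conv (κ q.1) ((box a b).indicator (w q.2)) -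
        (box a b).indicator (w q.2)) 2 volume := by
  have hg := (isWeakDiv_weakDiv hdiv).1
  have hmeas : ∀ {f : E d → ℝ}, MemLp f 2 (volume.restrict (box a b)) → ∀ s,
      AEStronglyMeasurable (conv (κ s) ((box a b).indicator f) - (box a b).indicator f) volume :=
    fun hf s => (aestronglyMeasurable_conv (hκ.smooth s)
      (hκ.compact s) (locallyIntegrable_indicator_box hf)).sub (memLp_indicator_box hf).1
  have h1 := eLpNorm_sum_smul_le (a := a) (b := b)
    (fun q : Finset (Fin d) × Fin d =>
      continuous_fderiv_basisVec (contDiff_cut (a := a) (b := b) q.1) q.2) hC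
    (F := fun q => conv (κ q.1) ((box a b).indicator (w q.2)) - (box a b).indicator (w q.2))
    fun q => hmeas (hw q.2) q.1
  refine le_trans ?_ (add_le_add (eLpNorm_glue_sub_le hκ hg) h1)
  have hm2 : AEStronglyMeasurable (fun x => ∑ q : Finset (Fin d) × Fin d,
      fderiv ℝ (cut a b q.1) x (basisVec q.2) •
        (conv (κ q.1) ((box a b).indicator (w q.2)) - (box a b).indicator (w q.2)) x)
      (volume.restrict (box a b)) := by
    refine Finset.aestronglyMeasurable_fun_sum _ fun q _ => ?_
    exact (continuous_fderiv_basisVec (contDiff_cut q.1) q.2).aestronglyMeasurable.smul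
      (hmeas (hw q.2) q.1).restrict
  refine le_trans (le_of_eq (eLpNorm_congr_ae ?_)) (eLpNorm_add_le
    ((contDiff_glue hκ hg).continuous.aestronglyMeasurable.sub hg.1) hm2 (by norm_num))
  filter_upwards [ae_restrict_mem (isOpen_box a b).measurableSet] with x hx
  -- Because of this identity `w q.2` can be subtracted inside the commutator sum, turning it into a
  -- sum of mollification errors.
  have hz : ∑ q : Finset (Fin d) × Fin d,
      fderiv ℝ (cut a b q.1) x (basisVec q.2) * w q.2 x = 0 := by
    rw [Fintype.sum_prod_type_right]
    refine Finset.sum_eq_zero fun i _ => ?_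
    dsimp only
    rw [← Finset.sum_mul, sum_fderiv_cut, zero_mul]
  have hs : ∀ s, cut a b s x *
      ∑ i, conv (fun t => fderiv ℝ (κ s) t (basisVec i)) ((box a b).indicator (w i)) x =
      cut a b s x * conv (κ s) ((box a b).indicator (weakDiv (box a b) w)) x := by
    intro s
    by_cases hcut : cut a b s x = 0
    · rw [hcut, zero_mul, zero_mul]
    · rw [sum_conv_fderiv_eq hκ hw hdiv htr hx hcut]
  simp only [Pi.sub_apply, Pi.add_apply, smul_eq_mul, mul_sub, Finset.sum_sub_distrib,
    indicator_of_mem hx, hz, sub_zero, glue]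
  rw [divGlue_eq hκ hw, Finset.sum_congr rfl fun s _ => hs s]
  ring

/-- For a fixed kernel, the divergence of the smoothed field is bounded by the field. -/
theorem exists_eLpNorm_divGlue_le (hκ : IsAdapted a b Ia Ib r κ) :
    ∃ K : ℝ≥0∞, K ≠ ⊤ ∧ ∀ w : Fin d → E d → ℝ,
      (∀ i, MemLp (w i) 2 (volume.restrict (box a b))) →
      eLpNorm (divGlue a b κ w) 2 (volume.restrict (box a b)) ≤
        K * ∑ i, eLpNorm (w i) 2 (volume.restrict (box a b)) := by
  obtain ⟨C, hC⟩ := exists_fderiv_cut_bound a b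
  -- No property of the divergence of `w` enters: the derivatives stay on the fixed kernels, at the
  -- price of a constant that depends on them.
  let κ' : Finset (Fin d) × Fin d → E d → ℝ := fun q t => fderiv ℝ (κ q.1) t (basisVec q.2)
  have hκ' : ∀ q, ContDiff ℝ ∞ (κ' q) := fun q => contDiff_fderiv_basisVec (hκ.smooth q.1) q.2
  have hκc' : ∀ q, HasCompactSupport (κ' q) := fun q => (hκ.compact q.1).fderiv_apply (𝕜 := ℝ) _
  refine ⟨∑ q : Finset (Fin d) × Fin d, ((∫⁻ t, ‖κ' q t‖ₑ) + C * ∫⁻ t, ‖κ q.1 t‖ₑ), ?_,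
    fun w hw => ?_⟩
  · refine ENNReal.sum_ne_top.2 fun q _ => ENNReal.add_ne_top.2 ⟨?_, ENNReal.mul_ne_top
      ENNReal.coe_ne_top ?_⟩
    · exact (lintegral_enorm_lt_top (hκ' q).continuous (hκc' q)).ne
    · exact (lintegral_enorm_lt_top (hκ.smooth q.1).continuous (hκ.compact q.1)).ne
  have hloc := fun i => locallyIntegrable_indicator_box (hw i)
  have hm1 := fun q : Finset (Fin d) × Fin d =>
    aestronglyMeasurable_conv (hκ' q) (hκc' q) (hloc q.2)
  have hm2 := fun q : Finset (Fin d) × Fin d =>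
    aestronglyMeasurable_conv (hκ.smooth q.1) (hκ.compact q.1) (hloc q.2)
  have hcutc := fun q : Finset (Fin d) × Fin d => (contDiff_cut (a := a) (b := b) q.1).continuous
  have hcutd := fun q : Finset (Fin d) × Fin d =>
      continuous_fderiv_basisVec (contDiff_cut (a := a) (b := b) q.1) q.2
  have h1 := eLpNorm_sum_smul_le (a := a) (b := b) hcutc (C := 1)
    (fun q x _ => abs_cut_le_one q.1 x) hm1
  have h2 := eLpNorm_sum_smul_le (a := a) (b := b) hcutd hC hm2
  have heq : divGlue a b κ w =
      (fun x => ∑ q : Finset (Fin d) × Fin d, cut a b q.1 x •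
        conv (κ' q) ((box a b).indicator (w q.2)) x) +
      fun x => ∑ q : Finset (Fin d) × Fin d, fderiv ℝ (cut a b q.1) x (basisVec q.2) •
        conv (κ q.1) ((box a b).indicator (w q.2)) x := by
    ext x
    rw [divGlue_eq hκ hw, Pi.add_apply, Fintype.sum_prod_type (f := fun q => cut a b q.1 x • _)]
    simp only [Finset.mul_sum, smul_eq_mul, κ']
  have hle : ∀ (k : E d → ℝ) (i : Fin d), Continuous k →
      eLpNorm (conv k ((box a b).indicator (w i))) 2 volume ≤
        (∫⁻ t, ‖k t‖ₑ) * ∑ i, eLpNorm (w i) 2 (volume.restrict (box a b)) := by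
    intro k i hk
    refine (eLpNorm_conv_le hk (memLp_indicator_box (hw i)).1).trans ?_
    rw [eLpNorm_indicator_eq_eLpNorm_restrict (isOpen_box a b).measurableSet]
    gcongr
    exact Finset.single_le_sum (f := fun i => eLpNorm (w i) 2 (volume.restrict (box a b)))
      (fun _ _ => zero_le) (Finset.mem_univ i)
  rw [heq]
  refine (eLpNorm_add_le
    (Finset.aestronglyMeasurable_fun_sum _ fun q _ =>
      (hcutc q).aestronglyMeasurable.smul (hm1 q).restrict)
    (Finset.aestronglyMeasurable_fun_sum _ fun q _ =>
      (hcutd q).aestronglyMeasurable.smul (hm2 q).restrict) (by norm_num)).trans ?_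
  refine (add_le_add h1 h2).trans ?_
  rw [← Finset.sum_add_distrib, Finset.sum_mul]
  refine Finset.sum_le_sum fun q _ => ?_
  rw [ENNReal.coe_one, one_mul, add_mul, mul_assoc]
  exact add_le_add (hle _ _ (hκ' q).continuous)
    (mul_le_mul_right (hle _ _ (hκ.smooth q.1).continuous) _)

theorem divGlue_sub (hκ : IsAdapted a b Ia Ib r κ) {w w' : Fin d → E d → ℝ}
    (hw : ∀ i, MemLp (w i) 2 (volume.restrict (box a b)))
    (hw' : ∀ i, MemLp (w' i) 2 (volume.restrict (box a b))) :
    divGlue a b κ (w - w') = divGlue a b κ w - divGlue a b κ w' := by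
  ext x
  simp only [divGlue, Pi.sub_apply, ← Finset.sum_sub_distrib]
  refine Finset.sum_congr rfl fun i _ => ?_
  rw [glue_sub hκ (hw i) (hw' i), fderiv_sub
    ((contDiff_glue hκ (hw i)).differentiable (by simp) x)
    ((contDiff_glue hκ (hw' i)).differentiable (by simp) x), _root_.sub_apply]

end

end

/-! ### Density for fields with values in a normed space -/

theorem exists_pos_mul_le {K ε : ℝ≥0∞} (hK : K ≠ ⊤) (hε : 0 < ε) : ∃ η > 0, K * η ≤ ε := by
  have h : Tendsto (fun η : ℝ≥0∞ => K * η) (𝓝[>] 0) (𝓝 (K * 0)) :=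
    (ENNReal.Tendsto.const_mul tendsto_id (Or.inr hK)).mono_left nhdsWithin_le_nhds
  rw [mul_zero] at h
  obtain ⟨η, h1, h2⟩ := ((h.eventually (ge_mem_nhds hε)).and self_mem_nhdsWithin).exists
  exact ⟨η, h2, h1⟩

theorem exists_pos_rpow_lt (N : ℕ) {ε : ℝ≥0∞} (hε : 0 < ε) :
    ∃ η > 0, ((N : ℝ≥0∞) * η ^ 2) ^ (1 / 2 : ℝ) < ε := by
  have h0 : Tendsto (fun η : ℝ≥0∞ => η ^ 2) (𝓝[>] 0) (𝓝 (0 ^ 2)) :=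
    ((ENNReal.continuous_pow 2).tendsto 0).mono_left nhdsWithin_le_nhds
  have h := ((ENNReal.continuous_rpow_const (y := (1 / 2 : ℝ))).tendsto _).comp
    (ENNReal.Tendsto.const_mul (a := (N : ℝ≥0∞)) h0 (Or.inr (ENNReal.natCast_ne_top N)))
  have e : ((N : ℝ≥0∞) * 0 ^ 2) ^ (1 / 2 : ℝ) = 0 := by norm_num
  rw [e] at h
  obtain ⟨η, h1, h2⟩ := ((h.eventually (gt_mem_nhds hε)).and self_mem_nhdsWithin).exists
  exact ⟨η, h2, h1⟩

section

variable {d : ℕ} {a b : Fin d → ℝ} {Ia Ib : Set (Fin d)}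

/-- The convolution of a simple function is a combination of its finitely many values with scalar
coefficients that do not depend on `L`. With `L` the embedding into the completion this gives the
approximation of the field, and with `L` a functional it gives that of the scalar field, with the
same coefficients. -/
theorem glue_simpleFunc {r : ℝ} {κ : Finset (Fin d) → E d → ℝ} (hκ : IsAdapted a b Ia Ib r κ)
    {F G : Type*} [NormedAddCommGroup F] [NormedSpace ℝ F] [NormedAddCommGroup G] [NormedSpace ℝ G]
    [CompleteSpace G] (L : F →L[ℝ] G) (φ : SimpleFunc (E d) F) (x : E d) :
    glue a b κ (fun t => L (φ t)) x =
      ∑ h ∈ φ.range, glue a b κ ((φ ⁻¹' {h}).indicator fun _ => (1 : ℝ)) x • L h := by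
  classical
  have hint : ∀ s (h : F), Integrable
      (fun t => κ s (x - t) • (φ ⁻¹' {h}).indicator (fun _ => (1 : ℝ)) t)
      (volume.restrict (box a b)) := by
    intro s h
    refine integrable_mul_of_memLp (memLp_box_of_continuous a b
      ((hκ.smooth s).continuous.comp (continuous_const.sub continuous_id)) 2) ?_
    exact (memLp_const 1).indicator (φ.measurableSet_preimage _)
  have hconv : ∀ s, conv (κ s) ((box a b).indicator fun t => L (φ t)) x =
      ∑ h ∈ φ.range,
        conv (κ s) ((box a b).indicator ((φ ⁻¹' {h}).indicator fun _ => (1 : ℝ))) x • L h := by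
    intro s
    simp only [conv_indicator]
    rw [Finset.sum_congr rfl fun h _ => (integral_smul_const (𝕜 := ℝ) _ (L h)).symm,
      ← integral_finsetSum _ fun h _ => (hint s h).smul_const _]
    congr 1
    ext t
    rw [Finset.sum_eq_single (φ t)]
    · simp [indicator]
    · intro h _ hne
      simp [indicator, hne.symm]
    · exact fun h => absurd (φ.mem_range_self t) h
  simp only [glue, hconv, Finset.smul_sum, Finset.sum_smul]
  rw [Finset.sum_comm]
  simp only [smul_assoc]

/-- Density of smooth finite rank fields supported away from `∂_D Σ`. Here `F` is a normed space,
not necessarily complete, and the divergence and the normal trace are those of `w = ℓ ∘ u`. -/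
theorem exists_finite_rank_approx {F : Type*} [NormedAddCommGroup F] [NormedSpace ℝ F]
    (hab : ∀ i, a i < b i) (ℓ : Fin d → F →L[ℝ] ℝ) {u : E d → F}
    (hu : MemLp u 2 (volume.restrict (box a b))) {w : Fin d → E d → ℝ}
    (hwu : ∀ i, w i =ᵐ[volume.restrict (box a b)] fun x => ℓ i (u x))
    (hdiv : HasL2Div (box a b) w) (htr : NormalTraceZeroOff (box a b) (bdryN a b Ia Ib) w)
    {ε : ℝ≥0∞} (hε : 0 < ε) :
    ∃ (T : Finset F) (ρ : F → E d → ℝ),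
      (∀ h, ρ h ∈ CcInfty (box a b) (closure (bdryD a b Ia Ib)) ℝ) ∧
      eLpNorm (fun x => u x - ∑ h ∈ T, ρ h x • h) 2 (volume.restrict (box a b)) ≤ ε ∧
      eLpNorm (weakDiv (box a b) (w - fun i x => ℓ i (∑ h ∈ T, ρ h x • h))) 2
        (volume.restrict (box a b)) ≤ ε := by
  have hε2 : 0 < ε / 2 := ENNReal.div_pos hε.ne' (by norm_num)
  have hw : ∀ i, MemLp (w i) 2 (volume.restrict (box a b)) := fun i =>
    ((ℓ i).comp_memLp' hu).ae_eq (hwu i).symm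
  have hg := (isWeakDiv_weakDiv hdiv).1
  -- Convolutions of `u` itself are formed only in the completion; they serve the error estimate and
  -- not the approximant.
  let c : F →L[ℝ] UniformSpace.Completion F := UniformSpace.Completion.toComplL
  have hc : ∀ x : F, ‖c x‖ = ‖x‖ := fun x => UniformSpace.Completion.norm_coe x
  have hcu : MemLp (fun x => c (u x)) 2 (volume.restrict (box a b)) := c.comp_memLp' hu
  obtain ⟨C, hC⟩ := exists_fderiv_cut_bound a b
  -- `N` adds up the coefficients of the mollification errors in `eLpNorm_divGlue_sub_le`.
  let N : ℝ≥0∞ := Fintype.card (Finset (Fin d)) + Fintype.card (Finset (Fin d) × Fin d) * C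
  have hN : N ≠ ⊤ := ENNReal.add_ne_top.2 ⟨ENNReal.natCast_ne_top _,
    ENNReal.mul_ne_top (ENNReal.natCast_ne_top _) ENNReal.coe_ne_top⟩
  obtain ⟨η, hη, hNη⟩ := exists_pos_mul_le hN hε2
  obtain ⟨r₁, hr₁, h₁⟩ := exists_eLpNorm_conv_sub_le (memLp_indicator_box hcu) hη
  obtain ⟨r₂, hr₂, h₂⟩ := exists_eLpNorm_conv_sub_le (memLp_indicator_box hg) hη
  choose r₃ hr₃ h₃ using fun i => exists_eLpNorm_conv_sub_le (memLp_indicator_box (hw i)) hη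
  obtain ⟨r, ⟨⟨⟨hr, hr'⟩, hr''⟩, hrw⟩, hrab⟩ : ∃ r : ℝ, (((0 < r ∧ r < r₁) ∧ r < r₂) ∧
      ∀ i, r < r₃ i) ∧ ∀ i, r < (b i - a i) / 3 := by
    have hlt : ∀ {q : ℝ}, 0 < q → ∀ᶠ r in 𝓝[>] (0 : ℝ), r < q := fun hq =>
      mem_nhdsWithin_of_mem_nhds (gt_mem_nhds hq)
    have h0 : ∀ᶠ r in 𝓝[>] (0 : ℝ), 0 < r := self_mem_nhdsWithin
    exact ((((h0.and (hlt hr₁)).and (hlt hr₂)).and (eventually_all.2 fun i => hlt (hr₃ i))).and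
      (eventually_all.2 fun i => hlt (by linarith [hab i]))).exists
  obtain ⟨κ, hκ⟩ := exists_isAdapted hab Ia Ib hr fun i => (hrab i).le
  -- The kernels are now fixed, so the bounds `K` and `M` may depend on them; the simple function is
  -- chosen afterwards, to the accuracy that `M` requires.
  obtain ⟨K, hK, hKw⟩ := exists_eLpNorm_divGlue_le hκ
  let M : ℝ≥0∞ := (∑ s, ∫⁻ t, ‖κ s t‖ₑ) + K * ∑ i, (‖ℓ i‖₊ : ℝ≥0∞)
  have hM : M ≠ ⊤ := by
    refine ENNReal.add_ne_top.2 ⟨ENNReal.sum_ne_top.2 fun s _ =>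
      (lintegral_enorm_lt_top (hκ.smooth s).continuous (hκ.compact s)).ne,
      ENNReal.mul_ne_top hK (ENNReal.sum_ne_top.2 fun i _ => ENNReal.coe_ne_top)⟩
  obtain ⟨ζ, hζ, hMζ⟩ := exists_pos_mul_le hM hε2
  obtain ⟨φ, hφ, hφL⟩ := hu.exists_simpleFunc_eLpNorm_sub_lt (by norm_num) hζ.ne'
  have hind : ∀ h : F, MemLp ((φ ⁻¹' {h}).indicator fun _ => (1 : ℝ)) 2
      (volume.restrict (box a b)) := fun h =>
    (memLp_const 1).indicator (φ.measurableSet_preimage _)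
  refine ⟨φ.range, fun h => glue a b κ ((φ ⁻¹' {h}).indicator fun _ => (1 : ℝ)),
    fun h => glue_mem_CcInfty hκ (hind h), ?_, ?_⟩
  · have hcφ : MemLp (fun x => c (φ x)) 2 (volume.restrict (box a b)) := c.comp_memLp' hφL
    have hsub : eLpNorm ((fun x => c (u x)) - fun x => c (φ x)) 2 (volume.restrict (box a b)) =
        eLpNorm (u - ⇑φ) 2 (volume.restrict (box a b)) := by
      refine eLpNorm_congr_norm_ae (Eventually.of_forall fun x => ?_)
      simp only [Pi.sub_apply, ← map_sub, hc]
    calc eLpNorm (fun x => u x - ∑ h ∈ φ.range,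
          glue a b κ ((φ ⁻¹' {h}).indicator fun _ => (1 : ℝ)) x • h) 2 (volume.restrict (box a b))
        -- The error is split into the smoothed error of the simple function and the smoothing error
        -- of `u`.
        = eLpNorm (glue a b κ ((fun x => c (u x)) - fun x => c (φ x)) -
            (glue a b κ (fun x => c (u x)) - fun x => c (u x))) 2 (volume.restrict (box a b)) := by
          refine eLpNorm_congr_norm_ae (Eventually.of_forall fun x => ?_)
          rw [glue_sub hκ hcu hcφ]
          simp only [Pi.sub_apply]
          rw [glue_simpleFunc hκ c φ x, ← hc, map_sub, map_sum]
          simp only [map_smul]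
          congr 1
          abel
      _ ≤ _ := eLpNorm_sub_le
          (contDiff_glue hκ (hcu.sub hcφ)).continuous.aestronglyMeasurable
          ((contDiff_glue hκ hcu).continuous.aestronglyMeasurable.sub hcu.1) (by norm_num)
      _ ≤ M * ζ + N * η := by
          refine add_le_add ?_ ?_
          · refine (eLpNorm_glue_le hκ (hcu.sub hcφ)).trans ?_
            rw [hsub]
            exact mul_le_mul' le_self_add hφ.le
          · refine (eLpNorm_glue_sub_le hκ hcu).trans ((Finset.sum_le_sum fun s _ =>
              h₁ (κ s) (hκ.smooth s).continuous (hκ.compact s) (hκ.nonneg s) (hκ.integral s)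
                fun t ht => (hκ.supp s t ht).trans hr').trans ?_)
            rw [Finset.sum_const, Finset.card_univ, nsmul_eq_mul]
            exact mul_le_mul' le_self_add le_rfl
      _ ≤ ε / 2 + ε / 2 := add_le_add hMζ hNη
      _ = ε := ENNReal.add_halves ε
  · have hwφ : ∀ i, MemLp (fun x => ℓ i (φ x)) 2 (volume.restrict (box a b)) := fun i =>
      (ℓ i).comp_memLp' hφL
    have hmean : (fun i x => ℓ i (∑ h ∈ φ.range,
        glue a b κ ((φ ⁻¹' {h}).indicator fun _ => (1 : ℝ)) x • h)) =
        fun i => glue a b κ fun x => ℓ i (φ x) := by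
      ext i x
      rw [glue_simpleFunc hκ (ℓ i) φ x, map_sum]
      simp only [map_smul]
    rw [hmean]
    have hsm := fun i => contDiff_glue hκ (hwφ i)
    have hwd := (isWeakDiv_weakDiv hdiv).sub hw
      (fun i => memLp_box_of_continuous a b (hsm i).continuous 2) (isWeakDiv_of_contDiff a b hsm)
    rw [eLpNorm_congr_ae (hwd.weakDiv_ae_eq (isOpen_box a b))]
    have hmeas : ∀ {v : Fin d → E d → ℝ}, (∀ i, MemLp (v i) 2 (volume.restrict (box a b))) →
        AEStronglyMeasurable (divGlue a b κ v) (volume.restrict (box a b)) := fun hv =>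
      (continuous_finsetSum _ fun i _ =>
        continuous_fderiv_basisVec (contDiff_glue hκ (hv i)) i).aestronglyMeasurable
    have hdsub := divGlue_sub hκ hw hwφ
    have hsubL : ∀ i, MemLp ((w - fun i x => ℓ i (φ x)) i) 2 (volume.restrict (box a b)) :=
      fun i => (hw i).sub (hwφ i)
    calc eLpNorm (weakDiv (box a b) w - divGlue a b κ fun i x => ℓ i (φ x)) 2
          (volume.restrict (box a b))
        -- The same splitting: the normal trace condition is used only for `w`, while the simple
        -- function enters through the bound for fixed kernels.
        = eLpNorm (divGlue a b κ (w - fun i x => ℓ i (φ x)) -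
            (divGlue a b κ w - weakDiv (box a b) w)) 2 (volume.restrict (box a b)) := by
          rw [hdsub]
          congr 1
          abel
      _ ≤ _ := eLpNorm_sub_le (hmeas hsubL) ((hmeas hw).sub hg.1) (by norm_num)
      _ ≤ M * ζ + N * η := by
          refine add_le_add ?_ ?_
          · refine (hKw _ hsubL).trans (le_trans ?_ (mul_le_mul' le_add_self le_rfl))
            rw [mul_assoc, Finset.sum_mul]
            refine mul_le_mul' le_rfl (Finset.sum_le_sum fun i _ => ?_)
            refine le_trans (eLpNorm_le_nnreal_smul_eLpNorm_of_ae_le_mul (g := u - ⇑φ)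
              (c := ‖ℓ i‖₊) ?_ 2) ?_
            · filter_upwards [hwu i] with x hx
              simp only [Pi.sub_apply, hx, ← map_sub]
              exact (ℓ i).le_opNNNorm _
            · rw [ENNReal.smul_def, smul_eq_mul]
              exact mul_le_mul' le_rfl hφ.le
          · refine (eLpNorm_divGlue_sub_le hκ hw hdiv htr hC).trans ?_
            have hs := fun s => h₂ (κ s) (hκ.smooth s).continuous (hκ.compact s) (hκ.nonneg s)
              (hκ.integral s) fun t ht => (hκ.supp s t ht).trans hr''
            have hq := fun q : Finset (Fin d) × Fin d => h₃ q.2 (κ q.1) (hκ.smooth q.1).continuous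
              (hκ.compact q.1) (hκ.nonneg q.1) (hκ.integral q.1)
              fun t ht => (hκ.supp q.1 t ht).trans (hrw q.2)
            refine (add_le_add (Finset.sum_le_sum fun s _ => hs s)
              (Finset.sum_le_sum fun q _ => mul_le_mul' le_rfl (hq q))).trans ?_
            rw [Finset.sum_const, Finset.sum_const, Finset.card_univ, Finset.card_univ,
              nsmul_eq_mul, nsmul_eq_mul, ← mul_assoc, ← add_mul]
      _ ≤ ε / 2 + ε / 2 := add_le_add hMζ hNη
      _ = ε := ENNReal.add_halves ε

theorem sum_smul_mem_CcInfty {S Γ : Set (E d)} {F G : Type*} [NormedAddCommGroup G]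
    [NormedSpace ℝ G] (T : Finset F) {ρ : F → E d → ℝ} (hρ : ∀ h, ρ h ∈ CcInfty S Γ ℝ)
    (c : F → G) : (fun x => ∑ h ∈ T, ρ h x • c h) ∈ CcInfty S Γ G := by
  refine ⟨ContDiff.sum fun h _ => (hρ h).1.smul contDiff_const, ?_⟩
  have hsub : closure S ∩ Function.support (fun x => ∑ h ∈ T, ρ h x • c h) ⊆
      ⋃ h ∈ T, closure S ∩ Function.support (ρ h) := by
    rintro x ⟨hx, hne⟩
    obtain ⟨h, hT, hh⟩ := Finset.exists_ne_zero_of_sum_ne_zero hne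
    exact mem_iUnion₂.2 ⟨h, hT, hx, fun h0 => hh (by rw [h0, zero_smul])⟩
  refine (closure_mono hsub).trans ?_
  rw [Finset.closure_biUnion]
  exact iUnion₂_subset fun h _ => (hρ h).2

theorem clm_comp_mem_CcInfty {S Γ : Set (E d)} {F G : Type*} [NormedAddCommGroup F]
    [NormedSpace ℝ F] [NormedAddCommGroup G] [NormedSpace ℝ G] (L : F →L[ℝ] G) {f : E d → F}
    (hf : f ∈ CcInfty S Γ F) : (fun x => L (f x)) ∈ CcInfty S Γ G := by
  refine ⟨L.contDiff.comp hf.1, (closure_mono (inter_subset_inter_right _ fun x hx h0 => ?_)).trans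
    hf.2⟩
  exact hx (by simp only [h0, map_zero])

/-- Density for fields with finitely many components in a normed space `H`, subject to a linear
constraint `K`; the scalar field is given by functionals of some of the components. -/
theorem exists_smooth_approx {H : Type*} [NormedAddCommGroup H] [NormedSpace ℝ H]
    (hab : ∀ i, a i < b i) {m : ℕ} (K : Submodule ℝ (Fin m → H)) (ℓ : H →L[ℝ] ℝ)
    (σ : Fin d → Fin m) {u : Fin m → E d → H}
    (hu : ∀ i, MemLp (u i) 2 (volume.restrict (box a b)))
    (huK : ∀ᵐ x ∂(volume.restrict (box a b)), (fun i => u i x) ∈ K)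
    (hdiv : HasL2Div (box a b) fun i x => ℓ (u (σ i) x))
    (htr : NormalTraceZeroOff (box a b) (bdryN a b Ia Ib) fun i x => ℓ (u (σ i) x))
    {ε : ℝ≥0∞} (hε : 0 < ε) :
    ∃ ψ : Fin m → E d → H, (∀ i, ψ i ∈ CcInfty (box a b) (closure (bdryD a b Ia Ib)) H) ∧
      (∀ x, (fun i => ψ i x) ∈ K) ∧
      (∀ i, eLpNorm ((u - ψ) i) 2 (volume.restrict (box a b)) ≤ ε) ∧
      eLpNorm (weakDiv (box a b) fun i x => ℓ ((u - ψ) (σ i) x)) 2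
        (volume.restrict (box a b)) ≤ ε := by
  classical
  -- The values on the null set where the constraint fails are replaced by zero, which gives a field
  -- with values in the subspace `K`.
  let u' : E d → K := fun x => if h : (fun i => u i x) ∈ K then ⟨fun i => u i x, h⟩ else 0
  have hu' : ∀ᵐ x ∂(volume.restrict (box a b)), (u' x : Fin m → H) = fun i => u i x := by
    filter_upwards [huK] with x hx
    simp only [u', dif_pos hx]
  have hu'L : MemLp u' 2 (volume.restrict (box a b)) := by
    have hc : MemLp (fun x => (u' x : Fin m → H)) 2 (volume.restrict (box a b)) :=
      (MemLp.of_eval hu).ae_eq (hu'.mono fun x hx => hx.symm)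
    -- Strong measurability passes to the subspace along the embedding; `K` is not assumed to be
    -- closed.
    exact ⟨(Topology.IsEmbedding.subtypeVal (p := (· ∈ K))).aestronglyMeasurable_comp_iff.1 hc.1,
      hc.2⟩
  obtain ⟨T, ρ, hρ, h1, h2⟩ := exists_finite_rank_approx (Ia := Ia) (Ib := Ib) hab
    (fun i => (ℓ.comp (ContinuousLinearMap.proj (σ i))).comp K.subtypeL) hu'L
    (fun i => by
      filter_upwards [hu'] with x hx
      simp [hx]) hdiv htr hε
  have hcoe : ∀ x i, ((∑ h ∈ T, ρ h x • h : K) : Fin m → H) i =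
      ∑ h ∈ T, ρ h x • (h : Fin m → H) i := by
    intro x i
    simp [Finset.sum_apply]
  refine ⟨fun i x => ((∑ h ∈ T, ρ h x • h : K) : Fin m → H) i, fun i => ?_,
    fun x => (∑ h ∈ T, ρ h x • h : K).2, fun i => le_trans (eLpNorm_mono_ae ?_) h1, ?_⟩
  · simp only [hcoe]
    exact sum_smul_mem_CcInfty T hρ fun h => (h : Fin m → H) i
  · filter_upwards [hu'] with x hx
    have e : (u - fun i x => ((∑ h ∈ T, ρ h x • h : K) : Fin m → H) i) i x =
        ((u' x - ∑ h ∈ T, ρ h x • h : K) : Fin m → H) i := by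
      rw [Submodule.coe_sub, Pi.sub_apply, hx]
      rfl
    rw [e]
    exact norm_le_pi_norm ((u' x - ∑ h ∈ T, ρ h x • h : K) : Fin m → H) i
  · simp only [Pi.sub_apply, map_sub]
    exact h2

end

/-! ### The spaces `𝒲` and `𝒱` -/

/-- The functional `f ↦ ∫_U ι f`. -/
def meanCLM {d : ℕ} {U : Set (E (d + 1))} {X : Type*} [NormedAddCommGroup X] [NormedSpace ℝ X]
    (ι : X →L[ℝ] Lp ℝ 1 (volume.restrict U)) : X →L[ℝ] ℝ :=
  (L1.integralCLM (α := E (d + 1)) (E := ℝ)).comp ι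

theorem meanCLM_apply {d : ℕ} {U : Set (E (d + 1))} {X : Type*} [NormedAddCommGroup X]
    [NormedSpace ℝ X] (ι : X →L[ℝ] Lp ℝ 1 (volume.restrict U)) (f : X) :
    meanCLM ι f = ∫ y in U, ι f y := by
  rw [← L1.integral_eq_integral, L1.integral_eq]
  rfl

/-- The divergence free fields of `H¹_#(Z_f, Γ)^n`. -/
def divFreeSubmodule {d : ℕ} (Zf : Set (E (d + 1))) :
    Submodule ℝ (Fin (d + 1) → H1PerZero Zf) where
  carrier := {v | DivFree v}
  zero_mem' := by simp [DivFree]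
  add_mem' := by
    intro v w hv hw
    have h : ∑ j, ((v + w) j : L2Jet Zf) (some j) =
        ∑ j, (v j : L2Jet Zf) (some j) + ∑ j, (w j : L2Jet Zf) (some j) := by
      rw [← Finset.sum_add_distrib]; rfl
    exact h.trans (by rw [hv, hw, add_zero])
  smul_mem' := by
    intro c v hv
    have h : ∑ j, ((c • v) j : L2Jet Zf) (some j) = c • ∑ j, (v j : L2Jet Zf) (some j) := by
      rw [Finset.smul_sum]; rfl
    exact h.trans (by rw [hv, smul_zero])

theorem isFiniteMeasure_restrict_of_subset_cell {d : ℕ} {Zf : Set (E (d + 1))}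
    (h : Zf ⊆ cell d) : IsFiniteMeasure ((volume : Measure (E (d + 1))).restrict Zf) := by
  refine ⟨?_⟩
  rw [Measure.restrict_apply_univ]
  refine lt_of_le_of_lt (measure_mono (h.trans ?_))
    (isBounded_box (fun _ : Fin (d + 1) => (-1 : ℝ)) fun _ => 1).measure_lt_top
  rintro y ⟨h1, h2⟩ i
  refine Fin.lastCases h2 (fun j => ?_) i
  exact ⟨by linarith [(h1 j).1], (h1 j).2⟩

/-- The functional `v ↦ ∫_{Z_f} v` on `H¹_#(Z_f, Γ)`. -/
def cellMean {d : ℕ} (Zf : Set (E (d + 1)))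
    [IsFiniteMeasure ((volume : Measure (E (d + 1))).restrict Zf)] : H1PerZero Zf →L[ℝ] ℝ :=
  (innerSL ℝ (indicatorConstLp 2 MeasurableSet.univ
    (measure_ne_top ((volume : Measure (E (d + 1))).restrict Zf) univ) (1 : ℝ))).comp
    ((PiLp.proj 2 (fun _ : Option (Fin (d + 1)) => Lp ℝ 2 (volume.restrict Zf)) none).comp
      (H1PerZero Zf).subtypeL)

theorem cellMean_apply {d : ℕ} (Zf : Set (E (d + 1)))
    [IsFiniteMeasure ((volume : Measure (E (d + 1))).restrict Zf)] (v : H1PerZero Zf) :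
    cellMean Zf v = ∫ y in Zf, (v : L2Jet Zf) none y := by
  have h := L2.inner_indicatorConstLp_one (𝕜 := ℝ) MeasurableSet.univ
    (measure_ne_top ((volume : Measure (E (d + 1))).restrict Zf) univ) ((v : L2Jet Zf) none)
  rw [Measure.restrict_univ] at h
  exact h

/-- Together with `exists_pos_rpow_lt` this reduces smallness of the norms of `𝒲` and `𝒱` to a bound
by `η` for each of their `k + 1` terms. -/
theorem add_sq_rpow_lt {k : ℕ} {A : Fin k → ℝ≥0∞} {B η ε : ℝ≥0∞} (hA : ∀ i, A i ≤ η) (hB : B ≤ η)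
    (h : (((k + 1 : ℕ) : ℝ≥0∞) * η ^ 2) ^ (1 / 2 : ℝ) < ε) :
    ((∑ i, A i ^ 2) + B ^ 2) ^ (1 / 2 : ℝ) < ε := by
  refine lt_of_le_of_lt (ENNReal.rpow_le_rpow ?_ (by norm_num)) h
  have h1 : ∑ i, A i ^ 2 ≤ ∑ _i : Fin k, η ^ 2 := Finset.sum_le_sum fun i _ =>
    pow_le_pow_left₀ zero_le (hA i) 2
  rw [Finset.sum_const, Finset.card_univ, Fintype.card_fin, nsmul_eq_mul] at h1
  rw [Nat.cast_add, Nat.cast_one, add_mul, one_mul]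
  exact add_le_add h1 (pow_le_pow_left₀ zero_le hB 2)

/-! ### Inclusions and density for `𝒲` and `𝒱` -/

section

variable {d : ℕ} {a b : Fin d → ℝ} {Ia Ib : Set (Fin d)}

theorem smooth_field_properties (hab : ∀ i, a i < b i) (hD : (bdryD a b Ia Ib).Nonempty)
    {w : Fin d → E d → ℝ} (hw : ∀ i, w i ∈ CcInfty (box a b) (bdryD a b Ia Ib) ℝ) :
    HasL2Div (box a b) w ∧ NormalTraceZeroOff (box a b) (bdryN a b Ia Ib) w := by
  refine ⟨⟨_, isWeakDiv_of_contDiff a b fun i => (hw i).1⟩, ?_⟩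
  cases d with
  -- In dimension zero there are no faces, which contradicts the nonemptiness of `∂_D Σ`.
  | zero =>
    obtain ⟨x, hx⟩ := hD
    rcases closure_bdryD_subset a b Ia Ib (subset_closure hx) with ⟨i, -⟩ | ⟨i, -⟩ <;>
      exact i.elim0
  | succ n => exact normalTraceZeroOff_of_mem_CcInfty hab hw

theorem mem_spaceW_of_mem_CcInfty (hab : ∀ i, a i < b i) (hD : (bdryD a b Ia Ib).Nonempty)
    {U : Set (E (d + 1))} {X : Type*} [NormedAddCommGroup X] [NormedSpace ℝ X]
    (ι : X →L[ℝ] Lp ℝ 1 (volume.restrict U)) {ψ : Fin d → E d → X}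
    (hψ : ∀ i, ψ i ∈ CcInfty (box a b) (bdryD a b Ia Ib) X) : ψ ∈ spaceW a b Ia Ib ι := by
  refine ⟨fun i => memLp_box_of_continuous a b (hψ i).1.continuous 2, ?_⟩
  refine smooth_field_properties hab hD fun i => ?_
  have h := clm_comp_mem_CcInfty (meanCLM ι) (hψ i)
  simp only [meanCLM_apply] at h
  exact h

theorem exists_approx_spaceW (hab : ∀ i, a i < b i) {U : Set (E (d + 1))} {X : Type*}
    [NormedAddCommGroup X] [NormedSpace ℝ X] (ι : X →L[ℝ] Lp ℝ 1 (volume.restrict U))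
    {u : Fin d → E d → X} (hu : u ∈ spaceW a b Ia Ib ι) {ε : ℝ≥0∞} (hε : 0 < ε) :
    ∃ ψ : Fin d → E d → X, (∀ i, ψ i ∈ CcInfty (box a b) (closure (bdryD a b Ia Ib)) X) ∧
      normW a b ι (u - ψ) < ε := by
  obtain ⟨η, hη, hηε⟩ := exists_pos_rpow_lt (d + 1) hε
  obtain ⟨hL, hdiv, htr⟩ := hu
  have hmean : ∀ v : Fin d → E d → X, mean ι v = fun i x => meanCLM ι (v i x) := fun v => by
    simp only [meanCLM_apply]
    rfl
  rw [hmean] at hdiv htr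
  obtain ⟨ψ, hψ, -, h1, h2⟩ := exists_smooth_approx hab ⊤ (meanCLM ι) id hL
    (Eventually.of_forall fun _ => trivial) hdiv htr hη
  refine ⟨ψ, hψ, add_sq_rpow_lt h1 ?_ hηε⟩
  rw [hmean]
  exact h2

variable {Zf : Set (E (d + 1))}

theorem spaceVInfty_subset_spaceV (hab : ∀ i, a i < b i) (hD : (bdryD a b Ia Ib).Nonempty)
    (hZ : Zf ⊆ cell d) :
    spaceVInfty a b (bdryD a b Ia Ib) Zf ⊆ spaceV a b Ia Ib Zf := by
  have := isFiniteMeasure_restrict_of_subset_cell hZ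
  rintro ψ ⟨hψ, hdf⟩
  refine ⟨fun i => memLp_box_of_continuous a b (hψ i).1.continuous 2, ?_, ?_⟩
  · filter_upwards [ae_restrict_mem (isOpen_box a b).measurableSet] with x hx
    exact hdf x hx
  · refine smooth_field_properties hab hD fun i => ?_
    have h := clm_comp_mem_CcInfty (cellMean Zf) (hψ i.castSucc)
    simp only [cellMean_apply] at h
    exact h

theorem exists_approx_spaceV (hab : ∀ i, a i < b i) (hZ : Zf ⊆ cell d)
    {u : Fin (d + 1) → E d → H1PerZero Zf} (hu : u ∈ spaceV a b Ia Ib Zf) {ε : ℝ≥0∞}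
    (hε : 0 < ε) :
    ∃ ψ ∈ spaceVInfty a b (closure (bdryD a b Ia Ib)) Zf, normV a b (u - ψ) < ε := by
  have := isFiniteMeasure_restrict_of_subset_cell hZ
  -- One term for each entry of the gradient, and one for the divergence of the mean.
  obtain ⟨η, hη, hηε⟩ := exists_pos_rpow_lt ((d + 1) * (d + 1) + 1) hε
  obtain ⟨hL, hdf, hdiv, htr⟩ := hu
  have hmean : ∀ v : Fin (d + 1) → E d → H1PerZero Zf,
      meanV v = fun i x => cellMean Zf (v i.castSucc x) := fun v => by
    simp only [cellMean_apply]
    rfl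
  rw [hmean] at hdiv htr
  obtain ⟨ψ, hψ, hK, h1, h2⟩ := exists_smooth_approx hab (divFreeSubmodule Zf) (cellMean Zf)
    Fin.castSucc hL hdf hdiv htr hη
  refine ⟨ψ, ⟨hψ, fun x _ => hK x⟩, ?_⟩
  have hbound : ∀ i (j : Fin (d + 1)), eLpNorm (fun x => ((u - ψ) i x : L2Jet Zf) (some j)) 2
      (volume.restrict (box a b)) ≤ η := fun i j =>
    -- Each entry of the gradient is bounded by the full `H¹` norm, in which the approximation
    -- already holds, so no Poincaré inequality is needed.
    le_trans (eLpNorm_mono fun x =>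
      PiLp.norm_apply_le (p := 2) ((u - ψ) i x : L2Jet Zf) (some j)) (h1 i)
  rw [← hmean] at h2
  have key := add_sq_rpow_lt (fun q : Fin ((d + 1) * (d + 1)) =>
    hbound (finProdFinEquiv.symm q).1 (finProdFinEquiv.symm q).2) h2 hηε
  rw [Equiv.sum_comp finProdFinEquiv.symm (fun q : Fin (d + 1) × Fin (d + 1) =>
    eLpNorm (fun x => ((u - ψ) q.1 x : L2Jet Zf) (some q.2)) 2 (volume.restrict (box a b)) ^ 2),
    Fintype.sum_prod_type] at key
  exact key

end

end ThinLayer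

end

theorem mainTheorem11 {d : ℕ} (a b : Fin d → ℝ) (hab : ∀ i, a i < b i) (Ia Ib : Set (Fin d))
    (hD : (ThinLayer.bdryD a b Ia Ib).Nonempty) (hN : (ThinLayer.bdryN a b Ia Ib).Nonempty) :
    -- density in `𝒲`
    (∀ (U : Set (ThinLayer.E (d + 1))), IsOpen U → Bornology.IsBounded U →
      ∀ (X : Type*) [NormedAddCommGroup X] [NormedSpace ℝ X] [CompleteSpace X]
        (ι : X →L[ℝ] Lp ℝ 1 (volume.restrict U)), Function.Injective ι →
        (∀ ψ : Fin d → ThinLayer.E d → X,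
          (∀ i, ψ i ∈ ThinLayer.CcInfty (ThinLayer.box a b) (ThinLayer.bdryD a b Ia Ib) X) →
            ψ ∈ ThinLayer.spaceW a b Ia Ib ι) ∧
        (∀ u ∈ ThinLayer.spaceW a b Ia Ib ι, ∀ ε : ℝ≥0∞, 0 < ε →
          ∃ ψ : Fin d → ThinLayer.E d → X,
            (∀ i, ψ i ∈
              ThinLayer.CcInfty (ThinLayer.box a b) (closure (ThinLayer.bdryD a b Ia Ib)) X) ∧
            ThinLayer.normW a b ι (u - ψ) < ε)) ∧
    -- density in `𝒱`
    (∀ Zf : Set (ThinLayer.E (d + 1)), ThinLayer.IsFluidCell Zf →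
      ThinLayer.spaceVInfty a b (ThinLayer.bdryD a b Ia Ib) Zf
          ⊆ ThinLayer.spaceV a b Ia Ib Zf ∧
      ∀ u ∈ ThinLayer.spaceV a b Ia Ib Zf, ∀ ε : ℝ≥0∞, 0 < ε →
        ∃ ψ ∈ ThinLayer.spaceVInfty a b (closure (ThinLayer.bdryD a b Ia Ib)) Zf,
          ThinLayer.normV a b (u - ψ) < ε) := by
  refine ⟨fun U _ _ X _ _ _ ι _ => ⟨fun ψ hψ => ThinLayer.mem_spaceW_of_mem_CcInfty hab hD ι hψ,
    fun u hu ε hε => ThinLayer.exists_approx_spaceW hab ι hu hε⟩, fun Zf hZ =>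
    ⟨ThinLayer.spaceVInfty_subset_spaceV hab hD hZ.subset,
      fun u hu ε hε => ThinLayer.exists_approx_spaceV hab hZ.subset hu hε⟩⟩
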